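/- Let $I=(-1,1)$, let $b,f\in H^1(I)$ be real-valued, and let $\underline b>0$ be a constant with $b(x)\ge\underline b$ for a.e. $x\in I$. For $0<\varepsilon\le 1$ let $u_\varepsilon\in H^1_0(I)$ be the weak solution of $-\varepsilon^2u_\varepsilon''+b\,u_\varepsilon=f$ in $I$, $u_\varepsilon(\pm1)=0$, i.e. $$B_\varepsilon(u_\varepsilon,v)=\int_I f v\,dx\quad\forall v\in H^1_0(I),\qquad B_\varepsilon(w,v):=\int_I\left(\varepsilon^2w'v'+b\,wv\right)dx,$$ and write $\|w\|_{1,\varepsilon,I}:=\left(\int_I(\varepsilon^2(w')^2+b\,w^2)\,dx\right)^{1/2}$. Put $\theta:=2\beta_*$ with $\beta_*:=2/\sqrt{\underline b}$. For $N\in\mathbb N$, $N\ge 1$, divisible by $4$, let $\phi(t):=-\ln\left(1-2t(1-2N^{-1})\right)$, and let the exponential mesh $\Delta_{eXp}$ (depending on $\varepsilon$ and $N$) have the nodes $$x_i=\begin{cases}-1+\varepsilon\theta\,\phi\left(\frac{2i}{N}\right), & i=0,\dots,N/4,\\[2pt] \frac{4i}{N}\left(1-\theta\varepsilon\ln(N/2)\right)-2+2\theta\varepsilon\ln(N/2),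 & i=N/4,\dots,3N/4,\\[2pt] 1-\varepsilon\theta\,\phi\left(2-\frac{2i}{N}\right), & i=3N/4,\dots,N.\end{cases}$$ Assume $\theta\varepsilon\ln(N/2)<1$, so that $-1=x_0<x_1<\dots<x_N=1$. Let $\mathcal S^1_0(\Delta_{eXp})$ be the space of all $w\in H^1_0(I)$ that are polynomials of degree at most $1$ on each $[x_{i-1},x_i]$, $i=1,\dots,N$, and let $u_\varepsilon^{\Delta_{eXp}}\in\mathcal S^1_0(\Delta_{eXp})$ be the $\mathbb P_1$ finite element approximation of $u_\varepsilon$, i.e. $B_\varepsilon(u_\varepsilon^{\Delta_{eXp}},v)=\int_I fv\,dx$ for all $v\in\mathcal S^1_0(\Delta_{eXp})$. Then there is a constant $C>0$, depending on $b$, $f$ and $\underline b$ but independent of $\varepsilon$ and $N$, such that for all $0<\varepsilon\le1$ and all $1\le N\le 1/\varepsilon$ as above $$\|u_\varepsilon-u_\varepsilon^{\Delta_{eXp}}\|_{1,\varepsilon,I}\le C\,N^{-1}.$$ -/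

import Mathlib

open MeasureTheory

open scoped ContDiff

noncomputable section

namespace ReactionDiffusion

/-- The interval `I = (-1, 1)`. -/
abbrev I : Set ℝ := Set.Ioo (-1) 1

/-- `g` is a weak (distributional) derivative of `u` on `I`:
`∫_I u φ' = - ∫_I g φ` for every `φ ∈ C_c^∞(I)`.
(Only used for `u, g ∈ L²(I)`, so that all integrals converge.) -/
def IsWeakDeriv (u g : ℝ → ℝ) : Prop :=
  ∀ φ : ℝ → ℝ, ContDiff ℝ ∞ φ → HasCompactSupport φ → tsupport φ ⊆ I →
    ∫ x in I, u x * deriv φ x = -∫ x in I, g x * φ x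

/-- `u ∈ H¹(I)`: `u ∈ L²(I)` has a weak derivative in `L²(I)`. Functions are identified when they
agree a.e. on `I`; values outside `I` play no role. -/
def MemH1 (u : ℝ → ℝ) : Prop :=
  MemLp u 2 (volume.restrict I) ∧
    ∃ g : ℝ → ℝ, MemLp g 2 (volume.restrict I) ∧ IsWeakDeriv u g

open Classical in
/-- The weak derivative in `L²(I)` (unique up to a.e. equality on `I`) of `u ∈ H¹(I)`. -/
def weakDeriv (u : ℝ → ℝ) : ℝ → ℝ :=
  if h : MemH1 u then h.2.choose else 0

/-- `u ∈ H¹₀(I)`: `u ∈ H¹(I)` has vanishing traces at `±1`, the traces being the boundary values of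
the representative that is continuous on `[-1, 1]`. -/
def MemH10 (u : ℝ → ℝ) : Prop :=
  MemH1 u ∧ ∃ w : ℝ → ℝ, ContinuousOn w (Set.Icc (-1) 1) ∧
    (∀ᵐ x ∂volume.restrict I, u x = w x) ∧ w (-1) = 0 ∧ w 1 = 0

/-- `B_ε(w, v) = ∫_I (ε² w' v' + b w v) dx`. -/
def bilin (ε : ℝ) (b w v : ℝ → ℝ) : ℝ :=
  ∫ x in I, (ε ^ 2 * weakDeriv w x * weakDeriv v x + b x * w x * v x)

/-- `F(v) = ∫_I f v dx`. -/
def load (f v : ℝ → ℝ) : ℝ :=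
  ∫ x in I, f x * v x

/-- The energy norm `‖w‖_{1,ε,I} = (∫_I (ε² (w')² + b w²) dx)^{1/2}`. -/
def energyNorm (ε : ℝ) (b w : ℝ → ℝ) : ℝ :=
  √(∫ x in I, (ε ^ 2 * weakDeriv w x ^ 2 + b x * w x ^ 2))

/-- `u ∈ H¹₀(I)` is the weak solution of `-ε² u'' + b u = f` in `I`, `u(±1) = 0`. -/
def IsWeakSolution (ε : ℝ) (b f u : ℝ → ℝ) : Prop :=
  MemH10 u ∧ ∀ v : ℝ → ℝ, MemH10 v → bilin ε b u v = load f v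

/-- `w ∈ S¹₀(Δ)` for the mesh `Δ` with nodes `x 0 < x 1 < ... < x N`: `w ∈ H¹₀(I)` and `w` is a
polynomial of degree at most one on each element `[x j, x (j + 1)]`. -/
def MemS10 (N : ℕ) (x : ℕ → ℝ) (w : ℝ → ℝ) : Prop :=
  MemH10 w ∧ ∀ j < N, ∃ p : Polynomial ℝ, p.natDegree ≤ 1 ∧
    ∀ᵐ y ∂volume.restrict (Set.Icc (x j) (x (j + 1))), w y = p.eval y

/-- `uΔ ∈ S¹₀(Δ)` is the `P₁` finite element (Galerkin) approximation on the mesh `Δ`. -/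
def IsGalerkinSolution (ε : ℝ) (b f : ℝ → ℝ) (N : ℕ) (x : ℕ → ℝ) (uΔ : ℝ → ℝ) : Prop :=
  MemS10 N x uΔ ∧ ∀ v : ℝ → ℝ, MemS10 N x v → bilin ε b uΔ v = load f v

/-- The mesh-generating function `φ(t) = -ln(1 - 2t(1 - 2/N))` of the exponential mesh. -/
def eXpPhi (N : ℕ) (t : ℝ) : ℝ :=
  -Real.log (1 - 2 * t * (1 - 2 / (N : ℝ)))

/-- The nodes `x_0, ..., x_N` of the exponential mesh with grading constant `θ`
(`N` is divisible by `4`). -/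
def eXpNode (θ ε : ℝ) (N i : ℕ) : ℝ :=
  if i ≤ N / 4 then
    -1 + ε * θ * eXpPhi N (2 * (i : ℝ) / N)
  else if i ≤ 3 * N / 4 then
    4 * (i : ℝ) / N * (1 - θ * ε * Real.log ((N : ℝ) / 2)) - 2 + 2 * θ * ε * Real.log ((N : ℝ) / 2)
  else
    1 - ε * θ * eXpPhi N (2 - 2 * (i : ℝ) / N)

/-- `β_* = 2 / √b₀`, where `b₀ > 0` is the lower bound of the reaction coefficient. -/
def betaStar (b₀ : ℝ) : ℝ := 2 / √b₀

/-- The grading constant `θ = 2 β_*`. -/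
def theta (b₀ : ℝ) : ℝ := 2 * betaStar b₀

end ReactionDiffusion

end

/-! By Galerkin orthogonality the finite element solution is the best approximation in the energy
norm (`energy_galerkin_le`), so it suffices to exhibit one discrete `v` whose squared energy error
is O(N⁻²) (`exists_approx`).

Decompose `u = u₀ - A E - B F - L + r`. Here `u₀ = f / b` solves the reduced equation, and `E`, `F`
are exponentials decaying away from -1 and 1 at the rates `√b(-1) / ε` and `√b(1) / ε`, with `b`
frozen at the end points. The coefficients are `A = u₀(-1)` and `B = u₀(1)`, and the affine `L`
cancels what each layer leaves at the opposite end, so that `r` vanishes at ±1. Each piece is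
approximated separately.

The remainder `r` is approximated by 0. Testing its equation with `r` gives squared energy O(ε²):
`u₀'` enters only through `ε² ∫ u₀' r'`, and freezing `b` costs little because `|b(y) - b(-1)|² ≤ (1
+ y) ‖b'‖²` while `∫ (1 + y) E² = O(ε²)`. Since `ε ≤ 1/N`, this suffices (`energy_residual_le`,
`integral_residual_sq_le`).

The function `u₀` is merely H¹, but element lengths and `ε` are both O(1/N), so first-order
interpolation bounds are enough (`energy_interp_le`).

On the left graded part the logarithm in the nodes turns `E` into a power at least 1 of equally
spaced numbers in (0, 1], so its jumps over elements are O(1/N); beyond that part `E` itself is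
O(1/N), and `F` is symmetric. Small jumps bound the energy density of the interpolation error
pointwise (`abs_layer_step_left`, `energy_interp_exp_le`). Finally `L` already is piecewise linear.
-/

noncomputable section

open Set Filter Topology

namespace ReactionDiffusion

/-! ### Calculus of absolutely continuous representatives -/

/-- `w` is absolutely continuous on `[-1, 1]` with a.e. derivative `g ∈ L²(I)`. -/
structure HasL2Deriv (w g : ℝ → ℝ) : Prop where
  ac : AbsolutelyContinuousOnInterval w (-1) 1
  ae_hasDerivAt : ∀ᵐ x ∂volume.restrict I, HasDerivAt w (g x) x
  memLp : MemLp g 2 (volume.restrict I)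

theorem restrict_Ioc_eq : volume.restrict (Ioc (-1 : ℝ) 1) = volume.restrict I :=
  Measure.restrict_congr_set Ioo_ae_eq_Ioc.symm

theorem restrict_Icc_eq : volume.restrict (Icc (-1 : ℝ) 1) = volume.restrict I :=
  Measure.restrict_congr_set Ioo_ae_eq_Icc.symm

theorem integral_I_eq (g : ℝ → ℝ) : ∫ x in I, g x = ∫ x in (-1 : ℝ)..1, g x := by
  rw [intervalIntegral.integral_of_le (by norm_num), restrict_Ioc_eq]

theorem intervalIntegrable_iff_I {g : ℝ → ℝ} :
    IntervalIntegrable g volume (-1) 1 ↔ Integrable g (volume.restrict I) := by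
  rw [intervalIntegrable_iff_integrableOn_Ioc_of_le (by norm_num), IntegrableOn, restrict_Ioc_eq]

theorem uIcc_eq : uIcc (-1 : ℝ) 1 = Icc (-1) 1 := uIcc_of_le (by norm_num)

theorem memLp_of_continuousOn {w : ℝ → ℝ} (hw : ContinuousOn w (Icc (-1) 1)) :
    MemLp w 2 (volume.restrict I) := by
  obtain ⟨C, hC⟩ := isCompact_Icc.exists_bound_of_continuousOn hw
  rw [← restrict_Icc_eq]
  refine MemLp.of_bound (hw.aestronglyMeasurable measurableSet_Icc) C ?_
  filter_upwards [ae_restrict_mem measurableSet_Icc] with x hx using hC x hx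

theorem integrable_mul_of_memLp {v w : ℝ → ℝ} (hv : MemLp v 2 (volume.restrict I))
    (hw : MemLp w 2 (volume.restrict I)) :
    Integrable (fun x => v x * w x) (volume.restrict I) :=
  hv.integrable_mul hw

theorem integrable_sq_of_memLp {v : ℝ → ℝ} (hv : MemLp v 2 (volume.restrict I)) :
    Integrable (fun x => v x ^ 2) (volume.restrict I) :=
  hv.integrable_sq

theorem memLp_continuousOn_mul {b w : ℝ → ℝ} (hb : ContinuousOn b (Icc (-1) 1))
    (hw : MemLp w 2 (volume.restrict I)) :
    MemLp (fun x => b x * w x) 2 (volume.restrict I) := by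
  obtain ⟨C, hC⟩ := isCompact_Icc.exists_bound_of_continuousOn hb
  have hbm : AEStronglyMeasurable b (volume.restrict I) := by
    rw [← restrict_Icc_eq]; exact hb.aestronglyMeasurable measurableSet_Icc
  refine MemLp.of_le_mul (c := C) hw (hbm.mul hw.1) ?_
  filter_upwards [ae_restrict_mem measurableSet_Ioo] with x hx
  rw [norm_mul]
  gcongr
  exact hC x (Ioo_subset_Icc_self hx)

theorem eqOn_of_ae_eq {v w : ℝ → ℝ} (hv : ContinuousOn v (Icc (-1) 1))
    (hw : ContinuousOn w (Icc (-1) 1)) (h : v =ᵐ[volume.restrict I] w) :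
    EqOn v w (Icc (-1) 1) := by
  rw [← restrict_Icc_eq] at h
  exact Measure.eqOn_Icc_of_ae_eq volume (by norm_num) h hv hw

/-- The continuous functions `w` and `max w c` agree a.e., hence everywhere on the closed interval;
this carries the lower bound on the coefficient to its representative, end points included. -/
theorem le_of_ae_le {w : ℝ → ℝ} {c : ℝ} (hw : ContinuousOn w (Icc (-1) 1))
    (h : ∀ᵐ x ∂volume.restrict I, c ≤ w x) : ∀ x ∈ Icc (-1 : ℝ) 1, c ≤ w x := by
  have h1 : EqOn w (fun x => max (w x) c) (Icc (-1) 1) := by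
    refine eqOn_of_ae_eq hw (hw.sup continuousOn_const) ?_
    filter_upwards [h] with x hx using (max_eq_left hx).symm
  intro x hx
  rw [h1 hx]
  exact le_max_right _ _

namespace HasL2Deriv

variable {v w g k : ℝ → ℝ}

theorem continuousOn (h : HasL2Deriv w g) : ContinuousOn w (Icc (-1) 1) := by
  simpa [uIcc_eq] using h.ac.continuousOn

theorem memLp_self (h : HasL2Deriv w g) : MemLp w 2 (volume.restrict I) :=
  memLp_of_continuousOn h.continuousOn

theorem intervalIntegrable (h : HasL2Deriv w g) : IntervalIntegrable g volume (-1) 1 :=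
  intervalIntegrable_iff_I.2 (h.memLp.integrable (by norm_num))

theorem add (hv : HasL2Deriv v k) (hw : HasL2Deriv w g) :
    HasL2Deriv (fun x => v x + w x) (fun x => k x + g x) where
  ac := hv.ac.add hw.ac
  ae_hasDerivAt := by
    filter_upwards [hv.ae_hasDerivAt, hw.ae_hasDerivAt] with x h1 h2 using h1.add h2
  memLp := hv.memLp.add hw.memLp

theorem sub (hv : HasL2Deriv v k) (hw : HasL2Deriv w g) :
    HasL2Deriv (fun x => v x - w x) (fun x => k x - g x) where
  ac := hv.ac.sub hw.ac
  ae_hasDerivAt := by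
    filter_upwards [hv.ae_hasDerivAt, hw.ae_hasDerivAt] with x h1 h2 using h1.sub h2
  memLp := hv.memLp.sub hw.memLp

theorem const_mul (c : ℝ) (hw : HasL2Deriv w g) :
    HasL2Deriv (fun x => c * w x) (fun x => c * g x) where
  ac := hw.ac.const_mul c
  ae_hasDerivAt := by
    filter_upwards [hw.ae_hasDerivAt] with x h using h.const_mul c
  memLp := hw.memLp.const_mul c

theorem mul (hv : HasL2Deriv v k) (hw : HasL2Deriv w g) :
    HasL2Deriv (fun x => v x * w x) (fun x => k x * w x + v x * g x) where
  ac := hv.ac.mul hw.ac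
  ae_hasDerivAt := by
    filter_upwards [hv.ae_hasDerivAt, hw.ae_hasDerivAt] with x h1 h2 using h1.mul h2
  memLp := by
    refine MemLp.add ?_ (memLp_continuousOn_mul hv.continuousOn hw.memLp)
    simpa only [mul_comm] using memLp_continuousOn_mul hw.continuousOn hv.memLp

theorem of_hasDerivAt (h : ∀ x, HasDerivAt w (g x) x) (hg : Continuous g) : HasL2Deriv w g where
  ac := by
    refine ContDiffOn.absolutelyContinuousOnInterval (ContDiff.contDiffOn ?_)
    rw [contDiff_one_iff_deriv]
    refine ⟨fun x => (h x).differentiableAt, ?_⟩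
    rwa [show deriv w = g from funext fun x => (h x).deriv]
  ae_hasDerivAt := Eventually.of_forall h
  memLp := memLp_of_continuousOn hg.continuousOn

theorem inv {c : ℝ} (hw : HasL2Deriv w g) (hc : 0 < c) (h : ∀ x ∈ Icc (-1 : ℝ) 1, c ≤ w x) :
    HasL2Deriv (fun x => (w x)⁻¹) (fun x => -g x / w x ^ 2) where
  ac := by
    have hac := hw.ac
    rw [absolutelyContinuousOnInterval_iff] at hac ⊢
    intro e he
    -- On values at least `c`, inversion is Lipschitz with constant `1 / c ^ 2`; the tolerance is
    -- rescaled accordingly.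
    obtain ⟨d, hd, hE⟩ := hac (e * c ^ 2) (by positivity)
    refine ⟨d, hd, fun E hE1 hE2 => ?_⟩
    have h3 := hE E hE1 hE2
    have hmem := hE1.1
    rw [uIcc_eq] at hmem
    calc _ ≤ ∑ i ∈ Finset.range E.1, dist (w (E.2 i).1) (w (E.2 i).2) / c ^ 2 := by
          refine Finset.sum_le_sum fun i hi => ?_
          obtain ⟨m1, m2⟩ := hmem i hi
          have a1 := h _ m1
          have a2 := h _ m2
          have p1 := hc.trans_le a1
          have p2 := hc.trans_le a2
          rw [Real.dist_eq, Real.dist_eq, inv_sub_inv p1.ne' p2.ne', abs_div, abs_sub_comm,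
            abs_of_pos (mul_pos p1 p2), sq]
          gcongr
      _ < e := by
          rw [← Finset.sum_div, div_lt_iff₀ (by positivity)]
          exact h3
  ae_hasDerivAt := by
    filter_upwards [hw.ae_hasDerivAt, ae_restrict_mem measurableSet_Ioo] with x h1 h2
    exact h1.inv (hc.trans_le (h x (Ioo_subset_Icc_self h2))).ne'
  memLp := by
    have h1 : ContinuousOn (fun x => -(w x ^ 2)⁻¹) (Icc (-1) 1) :=
      ((hw.continuousOn.pow 2).inv₀ fun x hx => by
        exact pow_ne_zero 2 (hc.trans_le (h x hx)).ne').neg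
    rw [show (fun x => -g x / w x ^ 2) = fun x => -(w x ^ 2)⁻¹ * g x from
      funext fun x => by ring]
    exact memLp_continuousOn_mul h1 hw.memLp

theorem div {c : ℝ} (hv : HasL2Deriv v k) (hw : HasL2Deriv w g) (hc : 0 < c)
    (h : ∀ x ∈ Icc (-1 : ℝ) 1, c ≤ w x) : ∃ l, HasL2Deriv (fun x => v x / w x) l :=
  ⟨_, by simpa only [div_eq_mul_inv] using hv.mul (hw.inv hc h)⟩

theorem integral_eq_sub (hw : HasL2Deriv w g) {a c : ℝ} (ha : a ∈ Icc (-1 : ℝ) 1)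
    (hc : c ∈ Icc (-1 : ℝ) 1) : ∫ x in a..c, g x = w c - w a := by
  have hsub : uIcc a c ⊆ uIcc (-1) 1 := by
    rw [uIcc_eq]; exact uIcc_subset_Icc ha hc
  rw [← (hw.ac.mono hsub).integral_deriv_eq_sub]
  refine intervalIntegral.integral_congr_ae ?_
  have h1 : ∀ᵐ x, x ∈ Ioc (-1 : ℝ) 1 → HasDerivAt w (g x) x := by
    rw [← ae_restrict_iff' measurableSet_Ioc, restrict_Ioc_eq]
    exact hw.ae_hasDerivAt
  filter_upwards [h1] with x hx hx2
  refine (hx ?_).deriv.symm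
  obtain ⟨h3, h4⟩ := hx2
  exact ⟨(le_min ha.1 hc.1).trans_lt h3, h4.trans (max_le ha.2 hc.2)⟩

theorem integral_parts (hv : HasL2Deriv v k) (hw : HasL2Deriv w g) (h1 : w (-1) = 0)
    (h2 : w 1 = 0) : ∫ x in I, v x * g x = -∫ x in I, k x * w x := by
  have h := (hv.mul hw).integral_eq_sub (a := -1) (c := 1) (by norm_num) (by norm_num)
  rw [← integral_I_eq, integral_add] at h
  · simp only [h1, h2, mul_zero, sub_zero] at h
    linarith
  · exact integrable_mul_of_memLp hv.memLp hw.memLp_self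
  · exact integrable_mul_of_memLp hv.memLp_self hw.memLp

/-- Cauchy–Schwarz, obtained from the nonnegative variance `∫ (g - m)²` with `m` the mean of `g`.
This is the only regularity estimate used for the H¹ data. -/
theorem sq_sub_le (hw : HasL2Deriv w g) {a c : ℝ} (hac : a ≤ c) (ha : -1 ≤ a) (hc : c ≤ 1) :
    (w c - w a) ^ 2 ≤ (c - a) * ∫ x in a..c, g x ^ 2 := by
  have hint : IntervalIntegrable (fun x => g x ^ 2) volume (-1) 1 :=
    intervalIntegrable_iff_I.2 (integrable_sq_of_memLp hw.memLp)
  have hsub : uIcc a c ⊆ uIcc (-1) 1 := by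
    rw [uIcc_eq]; exact uIcc_subset_Icc ⟨ha, hac.trans hc⟩ ⟨ha.trans hac, hc⟩
  have hi2 := hint.mono_set hsub
  have hi1 := hw.intervalIntegrable.mono_set hsub
  have hF := hw.integral_eq_sub (a := a) (c := c) ⟨ha, hac.trans hc⟩ ⟨ha.trans hac, hc⟩
  rcases hac.eq_or_lt with rfl | hlt
  · simp
  set m := (w c - w a) / (c - a) with hm
  have hpos : 0 < c - a := sub_pos.2 hlt
  have h0 : 0 ≤ ∫ x in a..c, (g x - m) ^ 2 :=
    intervalIntegral.integral_nonneg hac fun x _ => sq_nonneg _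
  have hexp : ∫ x in a..c, (g x - m) ^ 2 =
      (∫ x in a..c, g x ^ 2) - 2 * m * (∫ x in a..c, g x) + (c - a) * m ^ 2 := by
    rw [← intervalIntegral.integral_const_mul, ← intervalIntegral.integral_sub hi2 (hi1.const_mul _)]
    have : (c - a) * m ^ 2 = ∫ x in a..c, m ^ 2 := by simp
    rw [this, ← intervalIntegral.integral_add (hi2.sub (hi1.const_mul _)) (by simp)]
    exact intervalIntegral.integral_congr fun x _ => by ring
  rw [hexp, hF] at h0
  have hmm : w c - w a = m * (c - a) := by rw [hm]; field_simp
  rw [hmm] at h0 ⊢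
  have := mul_nonneg hpos.le h0
  nlinarith

theorem isWeakDeriv (hw : HasL2Deriv w g) : IsWeakDeriv w g := by
  intro φ hφ hc hs
  have hd : HasL2Deriv φ (deriv φ) :=
    .of_hasDerivAt (fun x => ((hφ.differentiable (by simp)) x).hasDerivAt)
      (hφ.continuous_deriv (by simp))
  refine hw.integral_parts hd ?_ ?_
  · exact image_eq_zero_of_notMem_tsupport fun h => by simpa using hs h
  · exact image_eq_zero_of_notMem_tsupport fun h => by simpa using hs h

theorem primitive (c : ℝ) (hg : MemLp g 2 (volume.restrict I)) :
    HasL2Deriv (fun x => c + ∫ t in (-1 : ℝ)..x, g t) g := by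
  have hi : IntervalIntegrable g volume (-1) 1 :=
    intervalIntegrable_iff_I.2 (hg.integrable (by norm_num))
  refine ⟨?_, ?_, hg⟩
  · have h1 : AbsolutelyContinuousOnInterval (fun _ : ℝ => c) (-1) 1 :=
      contDiff_const.contDiffOn.absolutelyContinuousOnInterval
    exact h1.add (hi.absolutelyContinuousOnInterval_intervalIntegral (by simp))
  · have := hi.ae_hasDerivAt_integral
    rw [ae_restrict_iff' measurableSet_Ioo]
    filter_upwards [this] with x hx hxI
    exact (hx (by rw [uIcc_eq]; exact Ioo_subset_Icc_self hxI) (-1) (by simp)).const_add c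

end HasL2Deriv

/-! ### From distributional derivatives to absolutely continuous representatives -/

theorem contDiff_primitive {η : ℝ → ℝ} (hη : ContDiff ℝ ∞ η) :
    ContDiff ℝ ∞ (fun x => ∫ t in (-1 : ℝ)..x, η t) ∧
      deriv (fun x => ∫ t in (-1 : ℝ)..x, η t) = η := by
  have hd : ∀ x, HasDerivAt (fun x => ∫ t in (-1 : ℝ)..x, η t) (η x) x := fun x =>
    intervalIntegral.integral_hasDerivAt_right (hη.continuous.intervalIntegrable _ _)
      (hη.continuous.stronglyMeasurableAtFilter _ _) hη.continuous.continuousAt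
  have hde : deriv (fun x => ∫ t in (-1 : ℝ)..x, η t) = η := funext fun x => (hd x).deriv
  refine ⟨?_, hde⟩
  rw [contDiff_infty_iff_deriv, hde]
  exact ⟨fun x => (hd x).differentiableAt, hη⟩

theorem exists_Icc_of_tsupport_subset {η : ℝ → ℝ} (hc : HasCompactSupport η)
    (hs : tsupport η ⊆ I) : ∃ d < (1 : ℝ), 0 < d ∧ ∀ x ∉ Icc (-d) d, η x = 0 := by
  rcases (tsupport η).eq_empty_or_nonempty with h | h
  · refine ⟨1 / 2, by norm_num, by norm_num, fun x _ => ?_⟩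
    exact image_eq_zero_of_notMem_tsupport (by rw [h]; simp)
  · obtain ⟨y, hy, hmax⟩ := IsCompact.exists_isMaxOn hc h (f := fun x => |x|)
      continuous_abs.continuousOn
    have hy1 : |y| < 1 := abs_lt.2 (hs hy)
    refine ⟨(|y| + 1) / 2, by linarith, by positivity, fun x hx => ?_⟩
    refine image_eq_zero_of_notMem_tsupport fun hx2 => hx ?_
    have h1 : |x| ≤ |y| := hmax hx2
    exact abs_le.1 (h1.trans (by linarith))

/-- A test function on `I` with vanishing integral is the derivative of a test function. -/
theorem exists_primitive_test {η : ℝ → ℝ} (hη : ContDiff ℝ ∞ η) (hc : HasCompactSupport η)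
    (hs : tsupport η ⊆ I) (h0 : ∫ x in I, η x = 0) :
    ∃ φ : ℝ → ℝ, ContDiff ℝ ∞ φ ∧ HasCompactSupport φ ∧ tsupport φ ⊆ I ∧ deriv φ = η := by
  obtain ⟨d, hd1, hd0, hd⟩ := exists_Icc_of_tsupport_subset hc hs
  obtain ⟨h1, h2⟩ := contDiff_primitive hη
  have hz : ∀ x ∉ Icc (-d) d, ∫ t in (-1 : ℝ)..x, η t = 0 := by
    intro x hx
    rw [integral_I_eq] at h0
    rcases lt_or_ge x (-d) with h | h
    · rw [intervalIntegral.integral_congr (g := fun _ => (0 : ℝ))]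
      · simp
      · intro t ht
        refine hd t fun ht2 => ?_
        have := ht.2
        rw [le_max_iff] at this
        rcases this with h' | h' <;> linarith [ht2.1]
    · have hx' : d < x := by
        by_contra hcon
        exact hx ⟨h, not_lt.1 hcon⟩
      rw [← intervalIntegral.integral_add_adjacent_intervals (b := 1)
        (hη.continuous.intervalIntegrable _ _) (hη.continuous.intervalIntegrable _ _), h0, zero_add,
        intervalIntegral.integral_congr (g := fun _ => (0 : ℝ))]
      · simp
      · intro t ht
        refine hd t fun ht2 => ?_
        have := ht.1
        rw [min_le_iff] at this
        rcases this with h' | h' <;> linarith [ht2.2]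
  have hts : tsupport (fun x => ∫ t in (-1 : ℝ)..x, η t) ⊆ Icc (-d) d := by
    refine closure_minimal (fun x hx => ?_) isClosed_Icc
    by_contra hcon
    exact hx (hz x hcon)
  refine ⟨_, h1, isCompact_Icc.of_isClosed_subset (isClosed_tsupport _) hts, fun x hx => ?_, h2⟩
  have := hts hx
  exact ⟨by linarith [this.1], by linarith [this.2]⟩

theorem exists_test_integral_eq_one : ∃ ψ : ℝ → ℝ, ContDiff ℝ ∞ ψ ∧ HasCompactSupport ψ ∧
    tsupport ψ ⊆ I ∧ ∫ x in I, ψ x = 1 := by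
  let B : ContDiffBump (0 : ℝ) := ⟨1 / 4, 1 / 2, by norm_num, by norm_num⟩
  have hts : tsupport (B.normed volume) ⊆ I := by
    rw [B.tsupport_normed_eq, Real.closedBall_eq_Icc]
    intro x hx
    have h1 := hx.1
    have h2 := hx.2
    simp only [B] at h1 h2
    constructor <;> linarith
  refine ⟨B.normed volume, B.contDiff_normed, B.hasCompactSupport_normed, hts, ?_⟩
  rw [setIntegral_eq_integral_of_forall_compl_eq_zero]
  · exact B.integral_normed
  · intro x hx
    exact image_eq_zero_of_notMem_tsupport fun h => hx (hts h)

theorem memLp_test {φ : ℝ → ℝ} (hφ : Continuous φ) : MemLp φ 2 (volume.restrict I) :=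
  memLp_of_continuousOn hφ.continuousOn

/-- The lemma of du Bois-Reymond. -/
theorem ae_eq_const_of_isWeakDeriv_zero {v : ℝ → ℝ} (hv : MemLp v 2 (volume.restrict I))
    (h : ∀ φ : ℝ → ℝ, ContDiff ℝ ∞ φ → HasCompactSupport φ → tsupport φ ⊆ I →
      ∫ x in I, v x * deriv φ x = 0) :
    ∃ c : ℝ, ∀ᵐ x ∂volume.restrict I, v x = c := by
  obtain ⟨ψ₀, s1, s2, s3, s4⟩ := exists_test_integral_eq_one
  refine ⟨∫ x in I, v x * ψ₀ x, ?_⟩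
  set c := ∫ x in I, v x * ψ₀ x with hcdef
  have hint : Integrable v (volume.restrict I) := hv.integrable (by norm_num)
  have hloc : LocallyIntegrableOn (fun x => v x - c) I volume :=
    IntegrableOn.locallyIntegrableOn (hint.sub (integrable_const c))
  have key := isOpen_Ioo.ae_eq_zero_of_integral_contDiff_smul_eq_zero hloc ?_
  · rw [ae_restrict_iff' measurableSet_Ioo]
    filter_upwards [key] with x hx hxI using sub_eq_zero.1 (hx hxI)
  intro ψ p1 p2 p3
  have hψi : Integrable ψ (volume.restrict I) := (memLp_test p1.continuous).integrable (by norm_num)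
  have hψ₀i : Integrable ψ₀ (volume.restrict I) :=
    (memLp_test s1.continuous).integrable (by norm_num)
  set m := ∫ x in I, ψ x with hm
  have hts : tsupport (fun x => ψ x - m * ψ₀ x) ⊆ tsupport ψ ∪ tsupport ψ₀ := by
    refine closure_minimal (fun x hx => ?_)
      ((isClosed_tsupport _).union (isClosed_tsupport _))
    by_contra hcon
    rw [mem_union, not_or] at hcon
    refine hx ?_
    simp [image_eq_zero_of_notMem_tsupport hcon.1, image_eq_zero_of_notMem_tsupport hcon.2]
  -- Subtracting `m ψ₀` removes the mean of `ψ`, which makes the difference an admissible `deriv φ`.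
  obtain ⟨φ, f1, f2, f3, f4⟩ := exists_primitive_test (η := fun x => ψ x - m * ψ₀ x)
    (p1.sub (contDiff_const.mul s1))
    ((IsCompact.union p2 s2).of_isClosed_subset (isClosed_tsupport _) hts)
    (hts.trans (union_subset p3 s3)) (by
      rw [integral_sub hψi (hψ₀i.const_mul m), integral_const_mul, s4]; simp [hm])
  have h1 := h φ f1 f2 f3
  rw [f4] at h1
  have i1 := integrable_mul_of_memLp hv (memLp_test p1.continuous)
  have i2 := integrable_mul_of_memLp hv (memLp_test s1.continuous)
  have h2 : ∫ x in I, v x * ψ x = m * c := by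
    have : ∫ x in I, v x * (ψ x - m * ψ₀ x) = (∫ x in I, v x * ψ x) - m * c := by
      rw [hcdef, ← integral_const_mul, ← integral_sub i1 (i2.const_mul m)]
      exact integral_congr_ae (Eventually.of_forall fun x => by ring)
    linarith
  rw [← setIntegral_eq_integral_of_forall_compl_eq_zero (s := I)]
  · have : ∫ x in I, ψ x • (v x - c) = (∫ x in I, v x * ψ x) - c * m := by
      rw [hm, ← integral_const_mul, ← integral_sub i1 (hψi.const_mul c)]
      exact integral_congr_ae (Eventually.of_forall fun x => by simp only [smul_eq_mul]; ring)
    rw [this, h2]; ring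
  · intro x hx
    rw [image_eq_zero_of_notMem_tsupport fun h => hx (p3 h), zero_smul]

/-- A function with a weak derivative `g ∈ L²(I)` has an absolutely continuous representative. -/
theorem exists_hasL2Deriv {u g : ℝ → ℝ} (hu : MemLp u 2 (volume.restrict I))
    (hg : MemLp g 2 (volume.restrict I)) (h : IsWeakDeriv u g) :
    ∃ w, u =ᵐ[volume.restrict I] w ∧ HasL2Deriv w g := by
  -- The primitive of `g` has the same weak derivative as `u`, so the two differ by a constant.
  have hW := HasL2Deriv.primitive 0 hg
  obtain ⟨c, hc⟩ := ae_eq_const_of_isWeakDeriv_zero (hu.sub hW.memLp_self) (by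
    intro φ f1 f2 f3
    have hφ := memLp_test (f1.continuous_deriv (by simp))
    have e1 := h φ f1 f2 f3
    have e2 := hW.isWeakDeriv φ f1 f2 f3
    have := integral_sub (integrable_mul_of_memLp hu hφ) (integrable_mul_of_memLp hW.memLp_self hφ)
    rw [e1, e2, sub_self] at this
    refine Eq.trans ?_ this
    exact integral_congr_ae (Eventually.of_forall fun x => by
      simp only [Pi.sub_apply, sub_mul]))
  refine ⟨_, ?_, HasL2Deriv.primitive c hg⟩
  filter_upwards [hc] with x hx
  simp only [Pi.sub_apply, zero_add] at hx
  linarith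

theorem MemH1.exists_rep {u : ℝ → ℝ} (hu : MemH1 u) :
    ∃ w, u =ᵐ[volume.restrict I] w ∧ HasL2Deriv w (weakDeriv u) := by
  have h := hu.2.choose_spec
  rw [weakDeriv, dif_pos hu]
  exact exists_hasL2Deriv hu.1 h.1 h.2

theorem HasL2Deriv.ae_eq_deriv {w v g k : ℝ → ℝ} (hw : HasL2Deriv w g) (hv : HasL2Deriv v k)
    (h : v =ᵐ[volume.restrict I] w) : k =ᵐ[volume.restrict I] g := by
  have heq := eqOn_of_ae_eq hv.continuousOn hw.continuousOn h
  filter_upwards [hw.ae_hasDerivAt, hv.ae_hasDerivAt, ae_restrict_mem measurableSet_Ioo]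
    with x h1 h2 hx
  refine h2.unique (h1.congr_of_eventuallyEq ?_)
  filter_upwards [isOpen_Ioo.mem_nhds hx] with y hy using heq (Ioo_subset_Icc_self hy)

theorem HasL2Deriv.memH1_of_ae_eq {u w g : ℝ → ℝ} (hw : HasL2Deriv w g)
    (h : u =ᵐ[volume.restrict I] w) : MemH1 u := by
  refine ⟨(memLp_congr_ae h).2 hw.memLp_self, g, hw.memLp, fun φ f1 f2 f3 => ?_⟩
  rw [← hw.isWeakDeriv φ f1 f2 f3]
  refine integral_congr_ae ?_
  filter_upwards [h] with x hx
  rw [hx]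

/-- Makes the arbitrary choice in `weakDeriv` harmless: energies and bilinear forms may be computed
with any absolutely continuous representative. -/
theorem HasL2Deriv.weakDeriv_ae_eq {u w g : ℝ → ℝ} (hw : HasL2Deriv w g)
    (h : u =ᵐ[volume.restrict I] w) : weakDeriv u =ᵐ[volume.restrict I] g := by
  obtain ⟨v, hv1, hv2⟩ := (hw.memH1_of_ae_eq h).exists_rep
  exact hw.ae_eq_deriv hv2 (hv1.symm.trans h)

theorem HasL2Deriv.memH10 {u w g : ℝ → ℝ} (hw : HasL2Deriv w g)
    (h : u =ᵐ[volume.restrict I] w) (h1 : w (-1) = 0) (h2 : w 1 = 0) : MemH10 u :=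
  ⟨hw.memH1_of_ae_eq h, w, hw.continuousOn, h, h1, h2⟩

theorem MemH10.exists_rep {u : ℝ → ℝ} (hu : MemH10 u) :
    ∃ w, u =ᵐ[volume.restrict I] w ∧ HasL2Deriv w (weakDeriv u) ∧ w (-1) = 0 ∧ w 1 = 0 := by
  obtain ⟨w, h1, h2⟩ := hu.1.exists_rep
  obtain ⟨v, c1, c2, c3, c4⟩ := hu.2
  have c2 : u =ᵐ[volume.restrict I] v := c2
  have heq := eqOn_of_ae_eq h2.continuousOn c1 (h1.symm.trans c2)
  exact ⟨w, h1, h2, (heq (by simp)).trans c3, (heq (by simp)).trans c4⟩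

/-! ### Energy, bilinear form and load on representatives -/

/-- The energy `∫_I (ε² g² + b w²)` of a function `w` with derivative `g`. -/
def energy (ε : ℝ) (b w g : ℝ → ℝ) : ℝ := ∫ x in I, (ε ^ 2 * g x ^ 2 + b x * w x ^ 2)

theorem energyNorm_eq {ε : ℝ} {b c u w g : ℝ → ℝ} (hb : b =ᵐ[volume.restrict I] c)
    (hu : u =ᵐ[volume.restrict I] w) (hw : HasL2Deriv w g) :
    energyNorm ε b u = √(energy ε c w g) := by
  rw [energyNorm, energy]
  congr 1
  refine integral_congr_ae ?_
  filter_upwards [hb, hu, hw.weakDeriv_ae_eq hu] with x h1 h2 h3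
  rw [h1, h2, h3]

theorem bilin_eq {ε : ℝ} {b c u w g v z k : ℝ → ℝ} (hb : b =ᵐ[volume.restrict I] c)
    (hu : u =ᵐ[volume.restrict I] w) (hw : HasL2Deriv w g)
    (hv : v =ᵐ[volume.restrict I] z) (hz : HasL2Deriv z k) :
    bilin ε b u v = ∫ x in I, (ε ^ 2 * g x * k x + c x * w x * z x) := by
  refine integral_congr_ae ?_
  filter_upwards [hb, hu, hw.weakDeriv_ae_eq hu, hv, hz.weakDeriv_ae_eq hv] with x h1 h2 h3 h4 h5
  rw [h1, h2, h3, h4, h5]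

theorem load_eq {f c v z : ℝ → ℝ} (hf : f =ᵐ[volume.restrict I] c)
    (hv : v =ᵐ[volume.restrict I] z) : load f v = ∫ x in I, c x * z x := by
  refine integral_congr_ae ?_
  filter_upwards [hf, hv] with x h1 h2
  rw [h1, h2]

/-! ### The exponential mesh with N = 4m elements -/

section Mesh

variable {θ ε : ℝ} {m : ℕ}

/-- The argument of the logarithm in the `i`-th node of the exponential mesh with `4 m` elements. -/
def meshArg (m i : ℕ) : ℝ := 1 - (i : ℝ) / m * (1 - 1 / (2 * m))

theorem meshArg_zero : meshArg m 0 = 1 := by simp [meshArg]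

theorem meshArg_self (hm : 0 < m) : meshArg m m = 1 / (2 * m) := by
  have : (m : ℝ) ≠ 0 := by positivity
  rw [meshArg, div_self this]; ring

theorem meshArg_sub_succ (i : ℕ) :
    meshArg m i - meshArg m (i + 1) = 1 / m * (1 - 1 / (2 * m)) := by
  simp only [meshArg, Nat.cast_add, Nat.cast_one]; ring

theorem one_div_two_mul_le (hm : 0 < m) : 1 / (2 * (m : ℝ)) ≤ 1 / 2 := by
  have : (1 : ℝ) ≤ m := by exact_mod_cast hm
  rw [div_le_div_iff₀ (by positivity) (by norm_num)]
  linarith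

theorem meshArg_step_pos (hm : 0 < m) (i : ℕ) : meshArg m (i + 1) < meshArg m i := by
  have h := one_div_two_mul_le hm
  have : 0 < 1 / (m : ℝ) * (1 - 1 / (2 * m)) := mul_pos (by positivity) (by linarith)
  linarith [meshArg_sub_succ (m := m) i]

theorem meshArg_step_le (hm : 0 < m) (i : ℕ) : meshArg m i - meshArg m (i + 1) ≤ 1 / m := by
  rw [meshArg_sub_succ]
  have h : 0 ≤ 1 / (2 * (m : ℝ)) := by positivity
  exact mul_le_of_le_one_right (by positivity) (by linarith)

theorem meshArg_ge (hm : 0 < m) {i : ℕ} (hi : i ≤ m) : 1 / (2 * (m : ℝ)) ≤ meshArg m i := by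
  rw [← meshArg_self hm]
  exact antitone_nat_of_succ_le (fun i => (meshArg_step_pos hm i).le) hi

theorem meshArg_pos (hm : 0 < m) {i : ℕ} (hi : i ≤ m) : 0 < meshArg m i :=
  lt_of_lt_of_le (by positivity) (meshArg_ge hm hi)

theorem meshArg_le_one (hm : 0 < m) (i : ℕ) : meshArg m i ≤ 1 := by
  rw [← meshArg_zero (m := m)]
  exact antitone_nat_of_succ_le (fun i => (meshArg_step_pos hm i).le) (Nat.zero_le i)

theorem eXpNode_left (hm : 0 < m) {i : ℕ} (hi : i ≤ m) :
    eXpNode θ ε (4 * m) i = -1 - ε * θ * Real.log (meshArg m i) := by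
  have : (m : ℝ) ≠ 0 := by positivity
  rw [eXpNode, if_pos (by omega), eXpPhi, meshArg]
  have : 1 - 2 * (2 * (i : ℝ) / ((4 * m : ℕ) : ℝ)) * (1 - 2 / ((4 * m : ℕ) : ℝ)) =
      1 - (i : ℝ) / m * (1 - 1 / (2 * m)) := by
    push_cast; field_simp; ring
  rw [this]; ring

theorem eXpNode_mid (hm : 0 < m) {i : ℕ} (hi : m ≤ i) (hi3 : i ≤ 3 * m) :
    eXpNode θ ε (4 * m) i = (i : ℝ) / m * (1 - θ * ε * Real.log (2 * m)) - 2 +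
      2 * θ * ε * Real.log (2 * m) := by
  have hm0 : (m : ℝ) ≠ 0 := by positivity
  rcases hi.eq_or_lt with rfl | hlt
  · rw [eXpNode_left hm le_rfl, meshArg_self hm, one_div, Real.log_inv, div_self hm0]; ring
  · rw [eXpNode, if_neg (by omega), if_pos (by omega)]
    have h1 : ((4 * m : ℕ) : ℝ) / 2 = 2 * m := by push_cast; ring
    have h2 : 4 * (i : ℝ) / ((4 * m : ℕ) : ℝ) = i / m := by push_cast; field_simp
    rw [h1, h2]

theorem eXpNode_right (hm : 0 < m) {i : ℕ} (hi : i ≤ m) :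
    eXpNode θ ε (4 * m) (4 * m - i) = 1 + ε * θ * Real.log (meshArg m i) := by
  have hm0 : (m : ℝ) ≠ 0 := by positivity
  rcases hi.eq_or_lt with rfl | hlt
  · rw [eXpNode_mid hm (by omega) (by omega), meshArg_self hm, one_div, Real.log_inv,
      show 4 * i - i = 3 * i by omega]
    push_cast
    field_simp
    ring
  · rw [eXpNode, if_neg (by omega), if_neg (by omega), eXpPhi, meshArg,
      Nat.cast_sub (by omega)]
    have : 1 - 2 * (2 - 2 * (((4 * m : ℕ) : ℝ) - i) / ((4 * m : ℕ) : ℝ)) *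
        (1 - 2 / ((4 * m : ℕ) : ℝ)) = 1 - (i : ℝ) / m * (1 - 1 / (2 * m)) := by
      push_cast; field_simp; ring
    rw [this]; ring

theorem eXpNode_symm (hm : 0 < m) {i : ℕ} (hi : i ≤ 4 * m) :
    eXpNode θ ε (4 * m) (4 * m - i) = -eXpNode θ ε (4 * m) i := by
  have hm0 : (m : ℝ) ≠ 0 := by positivity
  rcases le_total i m with h1 | h1
  · rw [eXpNode_right hm h1, eXpNode_left hm h1]; ring
  rcases le_total i (3 * m) with h2 | h2
  · rw [eXpNode_mid hm h1 h2, eXpNode_mid hm (by omega) (by omega), Nat.cast_sub (by omega)]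
    push_cast
    field_simp
    ring
  · have := eXpNode_right (θ := θ) (ε := ε) hm (i := 4 * m - i) (by omega)
    rw [show 4 * m - (4 * m - i) = i by omega] at this
    rw [this, eXpNode_left hm (by omega)]; ring

theorem eXpNode_zero (hm : 0 < m) : eXpNode θ ε (4 * m) 0 = -1 := by
  rw [eXpNode_left hm (Nat.zero_le _), meshArg_zero]; simp

theorem eXpNode_last (hm : 0 < m) : eXpNode θ ε (4 * m) (4 * m) = 1 := by
  have := eXpNode_symm (θ := θ) (ε := ε) hm (Nat.zero_le (4 * m))
  rw [eXpNode_zero hm] at this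
  simpa using this

theorem eXpNode_step_left (hθ : 0 < θ) (hε : 0 < ε) (hm : 0 < m) {i : ℕ} (hi : i < m) :
    0 < eXpNode θ ε (4 * m) (i + 1) - eXpNode θ ε (4 * m) i ∧
      eXpNode θ ε (4 * m) (i + 1) - eXpNode θ ε (4 * m) i ≤ 2 * θ * ε := by
  have p0 := meshArg_pos hm hi.le
  have p1 := meshArg_pos hm (Nat.succ_le_of_lt hi)
  have hlog : eXpNode θ ε (4 * m) (i + 1) - eXpNode θ ε (4 * m) i =
      ε * θ * (Real.log (meshArg m i) - Real.log (meshArg m (i + 1))) := by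
    rw [eXpNode_left hm hi.le, eXpNode_left hm hi]; ring
  rw [hlog]
  have hlt := Real.log_lt_log p1 (meshArg_step_pos hm i)
  refine ⟨mul_pos (by positivity) (by linarith), ?_⟩
  -- `log t ≤ t - 1` at the ratio of consecutive arguments: their gap is at most `1 / m` and the
  -- smaller one at least `1 / (2 * m)`.
  have hq : Real.log (meshArg m i) - Real.log (meshArg m (i + 1)) ≤ 2 := by
    rw [← Real.log_div p0.ne' p1.ne']
    refine (Real.log_le_sub_one_of_pos (div_pos p0 p1)).trans ?_
    have h1 := meshArg_ge hm (Nat.succ_le_of_lt hi)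
    have h2 := meshArg_step_le hm i
    have h3 : 1 / (m : ℝ) = 2 * (1 / (2 * m)) := by field_simp
    rw [sub_le_iff_le_add, div_le_iff₀ p1]
    linarith
  have := mul_le_mul_of_nonneg_left hq (by positivity : 0 ≤ ε * θ)
  linarith

/-- Graded elements have length at most `2θε`, hence O(1/N) by `hN`; uniform ones have length at
most `4 / N`. The right graded part is the reflection of the left one. -/
theorem eXpNode_step (hθ : 0 < θ) (hε : 0 < ε) (hm : 0 < m)
    (hL : θ * ε * Real.log (2 * m) < 1) (hN : ε ≤ 1 / (4 * m)) {i : ℕ} (hi : i < 4 * m) :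
    0 < eXpNode θ ε (4 * m) (i + 1) - eXpNode θ ε (4 * m) i ∧
      eXpNode θ ε (4 * m) (i + 1) - eXpNode θ ε (4 * m) i ≤ (2 * θ + 4) * (1 / (4 * m)) := by
  have hp : 0 < 1 / (4 * (m : ℝ)) := by positivity
  have hle : 2 * θ * ε ≤ (2 * θ + 4) * (1 / (4 * m)) := by nlinarith
  rcases lt_or_ge i m with h1 | h1
  · obtain ⟨a, b⟩ := eXpNode_step_left hθ hε hm h1
    exact ⟨a, b.trans hle⟩
  rcases lt_or_ge i (3 * m) with h2 | h2
  · rw [eXpNode_mid hm h1 h2.le, eXpNode_mid hm (by omega) (by omega)]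
    have hs : ((i + 1 : ℕ) : ℝ) / m * (1 - θ * ε * Real.log (2 * m)) - 2 +
        2 * θ * ε * Real.log (2 * m) - ((i : ℝ) / m * (1 - θ * ε * Real.log (2 * m)) - 2 +
        2 * θ * ε * Real.log (2 * m)) = 4 * (1 / (4 * m)) * (1 - θ * ε * Real.log (2 * m)) := by
      push_cast; field_simp; ring
    rw [hs]
    refine ⟨mul_pos (by positivity) (by linarith), ?_⟩
    have hlog : 0 ≤ Real.log (2 * m) := Real.log_nonneg (by
      have : (1 : ℝ) ≤ m := by exact_mod_cast hm
      linarith)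
    have : 0 ≤ θ * ε * Real.log (2 * m) := by positivity
    refine (mul_le_of_le_one_right (by positivity) (by linarith)).trans ?_
    gcongr
    linarith
  · obtain ⟨a, b⟩ := eXpNode_step_left hθ hε hm (i := 4 * m - (i + 1)) (by omega)
    rw [show 4 * m - (i + 1) + 1 = 4 * m - i by omega, eXpNode_symm hm hi.le,
      eXpNode_symm hm hi] at a b
    exact ⟨by linarith, by linarith⟩

theorem eXpNode_mono (hθ : 0 < θ) (hε : 0 < ε) (hm : 0 < m)
    (hL : θ * ε * Real.log (2 * m) < 1) (hN : ε ≤ 1 / (4 * m)) {i j : ℕ} (hij : i ≤ j)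
    (hj : j ≤ 4 * m) : eXpNode θ ε (4 * m) i ≤ eXpNode θ ε (4 * m) j := by
  induction j, hij using Nat.le_induction with
  | base => exact le_rfl
  | succ k hk ih =>
    exact (ih (by omega)).trans (by linarith [(eXpNode_step hθ hε hm hL hN (i := k) (by omega)).1])

/-- Bernoulli's inequality for `(x / y) ^ κ`, combined with `y ^ κ ≤ y`, gives the Lipschitz
constant `κ` of the power on (0, 1]. -/
theorem rpow_sub_rpow_le {x y κ : ℝ} (hx : 0 < x) (hxy : x ≤ y) (hy : y ≤ 1) (hκ : 1 ≤ κ) :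
    y ^ κ - x ^ κ ≤ κ * (y - x) := by
  have hy0 := hx.trans_le hxy
  have hB := one_add_mul_self_le_rpow_one_add (s := x / y - 1) (p := κ)
    (by linarith [div_pos hx hy0]) hκ
  rw [add_sub_cancel, Real.div_rpow hx.le hy0.le, le_div_iff₀ (Real.rpow_pos_of_pos hy0 κ)] at hB
  have h1 : y ^ κ ≤ y := by
    simpa using Real.rpow_le_rpow_of_exponent_ge hy0 hy hκ
  have h2 : y ^ κ * (1 - x / y) ≤ y * (1 - x / y) := by
    refine mul_le_mul_of_nonneg_right h1 ?_
    rw [sub_nonneg, div_le_one hy0]; exact hxy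
  have h3 : y * (1 - x / y) = y - x := by field_simp
  nlinarith

/-- The logarithm in the node cancels the exponential, leaving a power of arguments that are equally
spaced in `i`. -/
theorem exp_eXpNode_left (hε : 0 < ε) (hm : 0 < m) (a : ℝ) {i : ℕ} (hi : i ≤ m) :
    Real.exp (-(a / ε) * (1 + eXpNode θ ε (4 * m) i)) = meshArg m i ^ (a * θ) := by
  rw [eXpNode_left hm hi, Real.rpow_def_of_pos (meshArg_pos hm hi)]
  congr 1
  field_simp
  ring

/-- The exponential mesh equidistributes the boundary layer function at the left end point. -/
theorem abs_layer_step_left {a : ℝ} (hθ : 0 < θ) (hε : 0 < ε) (hm : 0 < m)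
    (hL : θ * ε * Real.log (2 * m) < 1) (hN : ε ≤ 1 / (4 * m)) (ha : 0 < a) (haθ : 1 ≤ a * θ)
    {i : ℕ} (hi : i < 4 * m) :
    |Real.exp (-(a / ε) * (1 + eXpNode θ ε (4 * m) (i + 1))) -
      Real.exp (-(a / ε) * (1 + eXpNode θ ε (4 * m) i))| ≤ (4 * (a * θ) + 2) * (1 / (4 * m)) := by
  have hp : 0 < 1 / (4 * (m : ℝ)) := by positivity
  rcases lt_or_ge i m with h1 | h1
  · rw [exp_eXpNode_left hε hm a h1, exp_eXpNode_left hε hm a h1.le, abs_sub_comm, abs_of_nonneg]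
    · refine (rpow_sub_rpow_le (meshArg_pos hm h1) (meshArg_step_pos hm i).le
        (meshArg_le_one hm i) haθ).trans ?_
      have := mul_le_mul_of_nonneg_left (meshArg_step_le hm i) (by positivity : 0 ≤ a * θ)
      have h4 : 1 / (m : ℝ) = 4 * (1 / (4 * m)) := by field_simp
      rw [h4] at this
      linarith
    · exact sub_nonneg.2 (Real.rpow_le_rpow (meshArg_pos hm h1).le (meshArg_step_pos hm i).le
        (by positivity))
  -- From the transition node on, monotonicity bounds the layer function by its value there, `(1 /
  -- (2m)) ^ (aθ) ≤ 2 / N`, so no jump can be larger.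
  · have hbd : ∀ j, m ≤ j → j ≤ 4 * m →
        Real.exp (-(a / ε) * (1 + eXpNode θ ε (4 * m) j)) ≤ 2 * (1 / (4 * m)) := by
      intro j hj hj4
      calc _ ≤ Real.exp (-(a / ε) * (1 + eXpNode θ ε (4 * m) m)) := by
            rw [Real.exp_le_exp, neg_mul, neg_mul, neg_le_neg_iff]
            have := eXpNode_mono hθ hε hm hL hN hj hj4
            gcongr
        _ = (1 / (2 * m)) ^ (a * θ) := by
            rw [exp_eXpNode_left hε hm a le_rfl, meshArg_self hm]
        _ ≤ 1 / (2 * m) := by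
            have h2 : 1 / (2 * (m : ℝ)) ≤ 1 := (one_div_two_mul_le hm).trans (by norm_num)
            simpa using Real.rpow_le_rpow_of_exponent_ge (by positivity) h2 haθ
        _ = 2 * (1 / (4 * m)) := by field_simp; norm_num
    have b1 := hbd i h1 hi.le
    have b2 := hbd (i + 1) (by omega) hi
    have e1 := Real.exp_pos (-(a / ε) * (1 + eXpNode θ ε (4 * m) i))
    have e2 := Real.exp_pos (-(a / ε) * (1 + eXpNode θ ε (4 * m) (i + 1)))
    have : 0 ≤ 4 * (a * θ) * (1 / (4 * m)) := by positivity
    rw [abs_le]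
    constructor <;> linarith

theorem abs_layer_step_right {a : ℝ} (hθ : 0 < θ) (hε : 0 < ε) (hm : 0 < m)
    (hL : θ * ε * Real.log (2 * m) < 1) (hN : ε ≤ 1 / (4 * m)) (ha : 0 < a) (haθ : 1 ≤ a * θ)
    {i : ℕ} (hi : i < 4 * m) :
    |Real.exp (-(a / ε) * (1 - eXpNode θ ε (4 * m) (i + 1))) -
      Real.exp (-(a / ε) * (1 - eXpNode θ ε (4 * m) i))| ≤ (4 * (a * θ) + 2) * (1 / (4 * m)) := by
  have h := abs_layer_step_left hθ hε hm hL hN ha haθ (i := 4 * m - (i + 1)) (by omega)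
  rw [show 4 * m - (i + 1) + 1 = 4 * m - i by omega, eXpNode_symm hm hi.le,
    eXpNode_symm hm hi, abs_sub_comm] at h
  simpa only [sub_eq_add_neg] using h

end Mesh

/-! ### Meshes and piecewise linear interpolation -/

/-- The points `x 0 < ... < x N` form a mesh of `[-1, 1]`. -/
structure IsMesh (N : ℕ) (x : ℕ → ℝ) : Prop where
  zero : x 0 = -1
  last : x N = 1
  lt : ∀ j < N, x j < x (j + 1)

namespace IsMesh

variable {N : ℕ} {x : ℕ → ℝ}

theorem mono (hx : IsMesh N x) {i j : ℕ} (hij : i ≤ j) (hj : j ≤ N) : x i ≤ x j := by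
  induction j, hij using Nat.le_induction with
  | base => exact le_rfl
  | succ k hk ih => exact (ih (by omega)).trans (hx.lt k (by omega)).le

theorem mem_Icc (hx : IsMesh N x) {j : ℕ} (hj : j ≤ N) : x j ∈ Icc (-1 : ℝ) 1 :=
  ⟨hx.zero ▸ hx.mono (Nat.zero_le j) hj, hx.last ▸ hx.mono hj le_rfl⟩

theorem exists_mem_Ioc (hx : IsMesh N x) {y : ℝ} (hy : y ∈ Ioc (-1 : ℝ) 1) :
    ∃ j < N, y ∈ Ioc (x j) (x (j + 1)) := by
  have hex : ∃ n, y ≤ x n := ⟨N, hx.last ▸ hy.2⟩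
  classical
  have hle : Nat.find hex ≤ N := Nat.find_min' hex (hx.last ▸ hy.2)
  have h0 : Nat.find hex ≠ 0 := fun h => by
    have := Nat.find_spec hex
    rw [h, hx.zero] at this
    exact absurd hy.1 (not_lt.2 this)
  obtain ⟨j, hj⟩ := Nat.exists_eq_succ_of_ne_zero h0
  refine ⟨j, by omega, ?_, by simpa [hj] using Nat.find_spec hex⟩
  exact not_le.1 (Nat.find_min hex (by omega))

theorem sum_integral (hx : IsMesh N x) {F : ℝ → ℝ} (hF : Integrable F (volume.restrict I)) :
    ∫ y in I, F y = ∑ j ∈ Finset.range N, ∫ y in x j..x (j + 1), F y := by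
  rw [integral_I_eq, intervalIntegral.sum_integral_adjacent_intervals, hx.zero, hx.last]
  intro k hk
  refine (intervalIntegrable_iff_I.2 hF).mono_set ?_
  rw [uIcc_eq]
  exact uIcc_subset_Icc (hx.mem_Icc hk.le) (hx.mem_Icc hk)

end IsMesh

/-- The slope of `w` on the `j`-th element. -/
def elementSlope (x : ℕ → ℝ) (w : ℝ → ℝ) (j : ℕ) : ℝ :=
  (w (x (j + 1)) - w (x j)) / (x (j + 1) - x j)

/-- The derivative of the piecewise linear interpolant. -/
def interpSlope (N : ℕ) (x : ℕ → ℝ) (w : ℝ → ℝ) (y : ℝ) : ℝ :=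
  ∑ j ∈ Finset.range N, (Ioc (x j) (x (j + 1))).indicator (fun _ => elementSlope x w j) y

/-- The piecewise linear nodal interpolant. -/
def interp (N : ℕ) (x : ℕ → ℝ) (w : ℝ → ℝ) (y : ℝ) : ℝ :=
  w (-1) + ∫ t in (-1 : ℝ)..y, interpSlope N x w t

section Interp

variable {N : ℕ} {x : ℕ → ℝ} {w g : ℝ → ℝ}

theorem interpSlope_eq (hx : IsMesh N x) {j : ℕ} (hj : j < N) {y : ℝ}
    (hy : y ∈ Ioc (x j) (x (j + 1))) : interpSlope N x w y = elementSlope x w j := by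
  rw [interpSlope, Finset.sum_eq_single j, indicator_of_mem hy]
  · intro i hi hij
    refine indicator_of_notMem (fun hyi => ?_) _
    rw [Finset.mem_range] at hi
    rcases lt_or_gt_of_ne hij with h | h
    · exact absurd (hy.1.trans_le hyi.2) (not_lt.2 (hx.mono h hj.le))
    · exact absurd (hyi.1.trans_le hy.2) (not_lt.2 (hx.mono h hi.le))
  · intro h
    exact absurd (Finset.mem_range.2 hj) h

theorem memLp_interpSlope : MemLp (interpSlope N x w) 2 (volume.restrict I) := by
  unfold interpSlope
  exact memLp_finsetSum _ fun j _ => (memLp_const _).indicator measurableSet_Ioc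

theorem hasL2Deriv_interp : HasL2Deriv (interp N x w) (interpSlope N x w) :=
  HasL2Deriv.primitive _ memLp_interpSlope

theorem interp_element_aux (hx : IsMesh N x) {j : ℕ} (hj : j < N) {y : ℝ}
    (hy : y ∈ Icc (x j) (x (j + 1))) :
    interp N x w y = interp N x w (x j) + elementSlope x w j * (y - x j) := by
  have hyI : y ∈ Icc (-1 : ℝ) 1 :=
    ⟨(hx.mem_Icc hj.le).1.trans hy.1, hy.2.trans (hx.mem_Icc hj).2⟩
  have h := (hasL2Deriv_interp (N := N) (x := x) (w := w)).integral_eq_sub (hx.mem_Icc hj.le) hyI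
  rw [intervalIntegral.integral_congr_ae (g := fun _ => elementSlope x w j)] at h
  · rw [intervalIntegral.integral_const, smul_eq_mul] at h
    linarith
  · refine Eventually.of_forall fun t ht => interpSlope_eq hx hj ?_
    rw [uIoc_of_le hy.1] at ht
    exact ⟨ht.1, ht.2.trans hy.2⟩

theorem interp_node (hx : IsMesh N x) {j : ℕ} (hj : j ≤ N) :
    interp N x w (x j) = w (x j) := by
  induction j with
  | zero => rw [hx.zero, interp, intervalIntegral.integral_same, add_zero]
  | succ k ih =>
    have hlt := hx.lt k hj
    rw [interp_element_aux hx hj ⟨hlt.le, le_rfl⟩, ih (by omega), elementSlope,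
      div_mul_cancel₀ _ (sub_ne_zero.2 hlt.ne')]
    ring

theorem interp_element (hx : IsMesh N x) {j : ℕ} (hj : j < N) {y : ℝ}
    (hy : y ∈ Icc (x j) (x (j + 1))) :
    interp N x w y = w (x j) + elementSlope x w j * (y - x j) := by
  rw [interp_element_aux hx hj hy, interp_node hx hj.le]

theorem interp_neg_one (hx : IsMesh N x) : interp N x w (-1) = w (-1) := by
  simpa [hx.zero] using interp_node (w := w) hx (Nat.zero_le N)

theorem interp_one (hx : IsMesh N x) : interp N x w 1 = w 1 := by
  simpa [hx.last] using interp_node (w := w) hx le_rfl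

theorem interp_eq_eval (hx : IsMesh N x) {j : ℕ} (hj : j < N) :
    ∃ p : Polynomial ℝ, p.natDegree ≤ 1 ∧
      ∀ y ∈ Icc (x j) (x (j + 1)), interp N x w y = p.eval y := by
  refine ⟨Polynomial.C (elementSlope x w j) * Polynomial.X +
    Polynomial.C (w (x j) - elementSlope x w j * x j), Polynomial.natDegree_linear_le,
    fun y hy => ?_⟩
  rw [interp_element hx hj hy]
  simp
  ring

theorem integrable_energy {ε : ℝ} {b : ℝ → ℝ} (hb : ContinuousOn b (Icc (-1) 1))
    (hw : HasL2Deriv w g) :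
    Integrable (fun y => ε ^ 2 * g y ^ 2 + b y * w y ^ 2) (volume.restrict I) := by
  refine ((integrable_sq_of_memLp hw.memLp).const_mul _).add ?_
  have := integrable_mul_of_memLp (memLp_continuousOn_mul hb hw.memLp_self) hw.memLp_self
  simpa only [sq, mul_assoc] using this

/-- No second derivative is available, so each element uses only Cauchy–Schwarz: the slope `σ`
satisfies `σ² d ≤ ∫ g²`, and both `w` and its interpolant deviate from the left nodal value by at
most `√(d ∫ g²)`. -/
theorem energy_interp_le {ε B h : ℝ} {b : ℝ → ℝ} (hx : IsMesh N x)
    (hb : ContinuousOn b (Icc (-1) 1)) (hB0 : 0 ≤ B) (hB : ∀ y ∈ Icc (-1 : ℝ) 1, b y ≤ B)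
    (hh : ∀ j < N, x (j + 1) - x j ≤ h) (hw : HasL2Deriv w g) :
    energy ε b (fun y => w y - interp N x w y) (fun y => g y - interpSlope N x w y) ≤
      (4 * ε ^ 2 + 4 * B * h ^ 2) * ∫ y in I, g y ^ 2 := by
  have hD := hw.sub (hasL2Deriv_interp (N := N) (x := x) (w := w))
  have hg2 := integrable_sq_of_memLp hw.memLp
  have hE := integrable_energy (ε := ε) hb hD
  rw [energy, hx.sum_integral hE, hx.sum_integral hg2, Finset.mul_sum]
  refine Finset.sum_le_sum fun j hj => ?_
  rw [Finset.mem_range] at hj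
  have hlt := hx.lt j hj
  have hxj := hx.mem_Icc hj.le
  have hxj1 := hx.mem_Icc hj
  have hsub : uIcc (x j) (x (j + 1)) ⊆ uIcc (-1) 1 := by
    rw [uIcc_eq]; exact uIcc_subset_Icc hxj hxj1
  have hig := (intervalIntegrable_iff_I.2 hg2).mono_set hsub
  have hiE := (intervalIntegrable_iff_I.2 hE).mono_set hsub
  set G := ∫ y in x j..x (j + 1), g y ^ 2 with hG
  set d := x (j + 1) - x j with hd
  set σ := elementSlope x w j with hσ
  have hd0 : 0 < d := sub_pos.2 hlt
  have hdh : d ≤ h := hh j hj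
  have hG0 : 0 ≤ G := intervalIntegral.integral_nonneg hlt.le fun _ _ => sq_nonneg _
  have hjump := hw.sq_sub_le hlt.le hxj.1 hxj1.2
  have hσd : σ * d = w (x (j + 1)) - w (x j) := by
    rw [hσ, elementSlope]; exact div_mul_cancel₀ _ hd0.ne'
  have hσG : σ ^ 2 * d ≤ G := by
    rw [← hσd] at hjump
    have : d * (σ ^ 2 * d) ≤ d * G := by linarith
    exact le_of_mul_le_mul_left this hd0
  have hmono : (∫ y in x j..x (j + 1), (ε ^ 2 * (g y - interpSlope N x w y) ^ 2 +
      b y * (w y - interp N x w y) ^ 2)) ≤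
      ∫ y in x j..x (j + 1), (2 * ε ^ 2 * g y ^ 2 + (2 * ε ^ 2 * σ ^ 2 + B * (4 * d * G))) := by
    refine intervalIntegral.integral_mono_on_of_le_Ioo hlt.le hiE
      ((hig.const_mul _).add (by simp)) fun y hy => ?_
    have hyI : y ∈ Icc (-1 : ℝ) 1 := ⟨hxj.1.trans hy.1.le, hy.2.le.trans hxj1.2⟩
    rw [interpSlope_eq hx hj (Ioo_subset_Ioc_self hy), interp_element hx hj (Ioo_subset_Icc_self hy),
      ← hσ]
    have h1 : (g y - σ) ^ 2 ≤ 2 * g y ^ 2 + 2 * σ ^ 2 := by nlinarith [sq_nonneg (g y + σ)]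
    have h2 : (w y - (w (x j) + σ * (y - x j))) ^ 2 ≤ 4 * d * G := by
      have k1 := hw.sq_sub_le hy.1.le hxj.1 hyI.2
      have k2 : ∫ t in x j..y, g t ^ 2 ≤ G :=
        intervalIntegral.integral_mono_interval le_rfl hy.1.le hy.2.le
          (Eventually.of_forall fun _ => sq_nonneg _) hig
      have k3 : 0 ≤ y - x j := sub_nonneg.2 hy.1.le
      have k4 : y - x j ≤ d := by linarith [hy.2]
      have k5 : (w y - w (x j)) ^ 2 ≤ d * G :=
        k1.trans ((mul_le_mul_of_nonneg_left k2 k3).trans (mul_le_mul_of_nonneg_right k4 hG0))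
      have k6 : (σ * (y - x j)) ^ 2 ≤ d * G := by
        have : (y - x j) ^ 2 ≤ d ^ 2 := pow_le_pow_left₀ k3 k4 2
        calc (σ * (y - x j)) ^ 2 = σ ^ 2 * (y - x j) ^ 2 := by ring
          _ ≤ σ ^ 2 * d ^ 2 := by gcongr
          _ = d * (σ ^ 2 * d) := by ring
          _ ≤ d * G := by gcongr
      nlinarith [sq_nonneg ((w y - w (x j)) + σ * (y - x j))]
    have h3 := mul_le_mul_of_nonneg_left h1 (sq_nonneg ε)
    have h4 := mul_le_mul (hB y hyI) h2 (sq_nonneg _) hB0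
    linarith
  refine hmono.trans ?_
  rw [intervalIntegral.integral_add (hig.const_mul _) (by simp),
    intervalIntegral.integral_const_mul, intervalIntegral.integral_const, smul_eq_mul, ← hG, ← hd]
  have hd2 : d ^ 2 ≤ h ^ 2 := pow_le_pow_left₀ hd0.le hdh 2
  have t1 := mul_le_mul_of_nonneg_left hσG (sq_nonneg ε)
  have t2 := mul_le_mul_of_nonneg_left hd2 (mul_nonneg hB0 hG0)
  nlinarith

theorem abs_sub_le_of_monotone_or_antitone (hmono : Monotone w ∨ Antitone w) {a c p q : ℝ}
    (hp : p ∈ Icc a c) (hq : q ∈ Icc a c) : |w p - w q| ≤ |w c - w a| := by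
  rcases hmono with h | h
  · rw [abs_of_nonneg (sub_nonneg.2 (h (hp.1.trans hp.2))), abs_le]
    constructor <;> linarith [h hp.1, h hp.2, h hq.1, h hq.2]
  · rw [abs_of_nonpos (sub_nonpos.2 (h (hp.1.trans hp.2))), abs_le]
    constructor <;> linarith [h hp.1, h hp.2, h hq.1, h hq.2]

/-- The interpolation error of an exponential is controlled by its jumps over the elements. -/
theorem energy_interp_exp_le {ε B δ l : ℝ} {b : ℝ → ℝ} (hx : IsMesh N x)
    (hb : ContinuousOn b (Icc (-1) 1)) (hB0 : 0 ≤ B) (hB : ∀ y ∈ Icc (-1 : ℝ) 1, b y ≤ B)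
    (hw : ∀ y, HasDerivAt w (l * w y) y) (hmono : Monotone w ∨ Antitone w)
    (hδ : ∀ j < N, |w (x (j + 1)) - w (x j)| ≤ δ) :
    energy ε b (fun y => w y - interp N x w y) (fun y => l * w y - interpSlope N x w y) ≤
      2 * ((ε * l) ^ 2 + B) * δ ^ 2 := by
  have hcont : Continuous w := continuous_iff_continuousAt.2 fun y => (hw y).continuousAt
  have hW : HasL2Deriv w (fun y => l * w y) := .of_hasDerivAt hw (continuous_const.mul hcont)
  have hD := hW.sub (hasL2Deriv_interp (N := N) (x := x) (w := w))
  have hbound : ∀ y ∈ I, ε ^ 2 * (l * w y - interpSlope N x w y) ^ 2 +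
      b y * (w y - interp N x w y) ^ 2 ≤ ((ε * l) ^ 2 + B) * δ ^ 2 := by
    intro y hy
    obtain ⟨j, hj, hyj⟩ := hx.exists_mem_Ioc (Ioo_subset_Ioc_self hy)
    have hyc := Ioc_subset_Icc_self hyj
    have hlt := hx.lt j hj
    have hd0 : 0 < x (j + 1) - x j := sub_pos.2 hlt
    rw [interpSlope_eq hx hj hyj, interp_element hx hj hyc]
    -- By the mean value theorem the element slope is `l * w ξ`, so the derivative error is `l`
    -- times an oscillation of the monotone `w`.
    obtain ⟨ξ, hξ, hξs⟩ := exists_hasDerivAt_eq_slope w (fun y => l * w y) hlt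
      hcont.continuousOn fun y _ => hw y
    have h1 : |l * w y - elementSlope x w j| ≤ |l| * δ := by
      rw [elementSlope, ← hξs, ← mul_sub, abs_mul]
      gcongr
      exact (abs_sub_le_of_monotone_or_antitone hmono hyc (Ioo_subset_Icc_self hξ)).trans (hδ j hj)
    have h2 : |w y - (w (x j) + elementSlope x w j * (y - x j))| ≤ δ := by
      set t := (y - x j) / (x (j + 1) - x j) with ht
      have ht0 : 0 ≤ t := div_nonneg (sub_nonneg.2 hyc.1) hd0.le
      have ht1 : t ≤ 1 := (div_le_one hd0).2 (by linarith [hyc.2])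
      -- The nodal error is a convex combination of the differences to the two end values, each at
      -- most `δ`.
      have hrw : w y - (w (x j) + elementSlope x w j * (y - x j)) =
          (1 - t) * (w y - w (x j)) + t * (w y - w (x (j + 1))) := by
        rw [elementSlope, ht]; field_simp; ring
      have a1 := (abs_sub_le_of_monotone_or_antitone hmono hyc (left_mem_Icc.2 hlt.le)).trans
        (hδ j hj)
      have a2 := (abs_sub_le_of_monotone_or_antitone hmono hyc (right_mem_Icc.2 hlt.le)).trans
        (hδ j hj)
      rw [hrw]
      refine (abs_add_le _ _).trans ?_
      rw [abs_mul, abs_mul, abs_of_nonneg ht0, abs_of_nonneg (sub_nonneg.2 ht1)]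
      have := mul_le_mul_of_nonneg_left a1 (sub_nonneg.2 ht1)
      have := mul_le_mul_of_nonneg_left a2 ht0
      linarith
    have s1 : (l * w y - elementSlope x w j) ^ 2 ≤ l ^ 2 * δ ^ 2 := by
      rw [← sq_abs, ← sq_abs l, ← mul_pow]
      exact pow_le_pow_left₀ (abs_nonneg _) h1 2
    have s2 : (w y - (w (x j) + elementSlope x w j * (y - x j))) ^ 2 ≤ δ ^ 2 := by
      rw [← sq_abs]
      exact pow_le_pow_left₀ (abs_nonneg _) h2 2
    have t1 := mul_le_mul_of_nonneg_left s1 (sq_nonneg ε)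
    have t2 := mul_le_mul (hB y (Ioo_subset_Icc_self hy)) s2 (sq_nonneg _) hB0
    linarith
  calc _ ≤ ∫ _ in I, ((ε * l) ^ 2 + B) * δ ^ 2 :=
        setIntegral_mono_on (integrable_energy hb hD) (integrable_const _) measurableSet_Ioo hbound
    _ = 2 * ((ε * l) ^ 2 + B) * δ ^ 2 := by
        rw [integral_I_eq, intervalIntegral.integral_const, smul_eq_mul]; ring

end Interp

/-! ### Energy identities and the remainder estimate -/

section Energy

variable {ε : ℝ} {b v w g k : ℝ → ℝ}

theorem integrable_bilin (hb : ContinuousOn b (Icc (-1) 1)) (hv : HasL2Deriv v k)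
    (hw : HasL2Deriv w g) :
    Integrable (fun y => ε ^ 2 * k y * g y + b y * v y * w y) (volume.restrict I) := by
  refine Integrable.add ?_ ?_
  · exact integrable_mul_of_memLp (hv.memLp.const_mul (ε ^ 2)) hw.memLp
  · exact integrable_mul_of_memLp (memLp_continuousOn_mul hb hv.memLp_self) hw.memLp_self

theorem energy_nonneg (hb : ∀ y ∈ Icc (-1 : ℝ) 1, 0 ≤ b y) : 0 ≤ energy ε b w g := by
  refine setIntegral_nonneg measurableSet_Ioo fun y hy => ?_
  have := hb y (Ioo_subset_Icc_self hy)
  positivity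

theorem energy_add_le (hb : ContinuousOn b (Icc (-1) 1)) (hb0 : ∀ y ∈ Icc (-1 : ℝ) 1, 0 ≤ b y)
    (hv : HasL2Deriv v k) (hw : HasL2Deriv w g) :
    energy ε b (fun y => v y + w y) (fun y => k y + g y) ≤
      2 * energy ε b v k + 2 * energy ε b w g := by
  have i1 := integrable_energy (ε := ε) hb hv
  have i2 := integrable_energy (ε := ε) hb hw
  simp only [energy]
  rw [← integral_const_mul, ← integral_const_mul,
    ← integral_add (i1.const_mul _) (i2.const_mul _)]
  refine setIntegral_mono_on (integrable_energy hb (hv.add hw))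
    ((i1.const_mul _).add (i2.const_mul _)) measurableSet_Ioo fun y hy => ?_
  have h1 := mul_nonneg (sq_nonneg ε) (sq_nonneg (k y - g y))
  have h2 := mul_nonneg (hb0 y (Ioo_subset_Icc_self hy)) (sq_nonneg (v y - w y))
  linarith

theorem energy_const_mul (c : ℝ) :
    energy ε b (fun y => c * w y) (fun y => c * g y) = c ^ 2 * energy ε b w g := by
  rw [energy, energy, ← integral_const_mul]
  exact integral_congr_ae (Eventually.of_forall fun y => by ring)

/-- Pythagoras for the inner product `B_ε`. -/
theorem energy_le_of_orthogonal (hb : ContinuousOn b (Icc (-1) 1))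
    (hb0 : ∀ y ∈ Icc (-1 : ℝ) 1, 0 ≤ b y) (hv : HasL2Deriv v k) (hw : HasL2Deriv w g)
    (horth : ∫ y in I, (ε ^ 2 * k y * g y + b y * v y * w y) = 0) :
    energy ε b v k ≤ energy ε b (fun y => v y + w y) (fun y => k y + g y) := by
  have i1 := integrable_energy (ε := ε) hb hv
  have i2 := integrable_energy (ε := ε) hb hw
  have i3 := integrable_bilin (ε := ε) hb hv hw
  have : energy ε b (fun y => v y + w y) (fun y => k y + g y) =
      energy ε b v k + 2 * (∫ y in I, (ε ^ 2 * k y * g y + b y * v y * w y)) +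
        energy ε b w g := by
    simp only [energy]
    rw [← integral_const_mul, ← integral_add i1 (i3.const_mul 2),
      ← integral_add (i1.fun_add (i3.const_mul 2)) i2]
    exact integral_congr_ae (Eventually.of_forall fun y => by ring)
  rw [this, horth]
  linarith [energy_nonneg (ε := ε) (w := w) (g := g) hb0]

/-- A priori bound for `r = u - u₀ + P`, where `u` is the weak solution, `b u₀ = f` and `P` is a
corrector. -/
theorem energy_residual_le {f u u' u₀ u₀' P P₁ P₂ r r' : ℝ → ℝ} {b₀ : ℝ} (hb₀ : 0 < b₀)
    (hb : ContinuousOn b (Icc (-1) 1)) (hbb₀ : ∀ y ∈ Icc (-1 : ℝ) 1, b₀ ≤ b y)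
    (hu : HasL2Deriv u u') (hu₀ : HasL2Deriv u₀ u₀') (hP : HasL2Deriv P P₁)
    (hP₁ : HasL2Deriv P₁ P₂) (hr : HasL2Deriv r r') (hrdef : ∀ y, r y = u y - u₀ y + P y)
    (hrdef' : ∀ y, r' y = u' y - u₀' y + P₁ y) (hr1 : r (-1) = 0) (hr2 : r 1 = 0)
    (hf : ∀ y ∈ Icc (-1 : ℝ) 1, b y * u₀ y = f y)
    (hweak : ∫ y in I, (ε ^ 2 * u' y * r' y + b y * u y * r y) = ∫ y in I, f y * r y) :
    energy ε b r r' ≤ ε ^ 2 * (∫ y in I, u₀' y ^ 2) +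
      b₀⁻¹ * ∫ y in I, (b y * P y - ε ^ 2 * P₂ y) ^ 2 := by
  have hq : MemLp (fun y => b y * P y - ε ^ 2 * P₂ y) 2 (volume.restrict I) :=
    (memLp_continuousOn_mul hb hP.memLp_self).sub (hP₁.memLp.const_mul _)
  have iq2 := integrable_sq_of_memLp hq
  have iu2 := integrable_sq_of_memLp hu₀.memLp
  have iE := integrable_energy (ε := ε) hb hr
  have iB := integrable_bilin (ε := ε) hb hu hr
  have iur := integrable_mul_of_memLp hu₀.memLp hr.memLp
  have iqr := integrable_mul_of_memLp hq hr.memLp_self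
  have iP1 := integrable_mul_of_memLp hP₁.memLp_self hr.memLp
  have iP2 := integrable_mul_of_memLp hP₁.memLp hr.memLp_self
  have ifr : Integrable (fun y => f y * r y) (volume.restrict I) := by
    refine (integrable_mul_of_memLp (memLp_continuousOn_mul hb hu₀.memLp_self)
      hr.memLp_self).congr ?_
    filter_upwards [ae_restrict_mem measurableSet_Ioo] with y hy
    rw [hf y (Ioo_subset_Icc_self hy)]
  have hparts := hP₁.integral_parts hr hr1 hr2
  -- Uses the weak equation with test function `r`, `b u₀ = f`, and integration by parts on `P₁`
  -- only; `u₀` need not have a second derivative.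
  have hid : energy ε b r r' = -(ε ^ 2 * ∫ y in I, u₀' y * r' y) +
      ∫ y in I, (b y * P y - ε ^ 2 * P₂ y) * r y := by
    have e1 : energy ε b r r' = (∫ y in I, (ε ^ 2 * u' y * r' y + b y * u y * r y)) -
        (∫ y in I, f y * r y) - ε ^ 2 * (∫ y in I, u₀' y * r' y) +
        ε ^ 2 * (∫ y in I, P₁ y * r' y) + ε ^ 2 * (∫ y in I, P₂ y * r y) +
        ∫ y in I, (b y * P y - ε ^ 2 * P₂ y) * r y := by
      have i1 : Integrable (fun y => ε ^ 2 * u' y * r' y + b y * u y * r y - f y * r y)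
        (volume.restrict I) := iB.sub ifr
      have i2 : Integrable (fun y => ε ^ 2 * u' y * r' y + b y * u y * r y - f y * r y -
        ε ^ 2 * (u₀' y * r' y)) (volume.restrict I) := i1.sub (iur.const_mul _)
      have i3 := i2.fun_add (iP1.const_mul (ε ^ 2))
      have i4 := i3.fun_add (iP2.const_mul (ε ^ 2))
      rw [← integral_const_mul, ← integral_const_mul, ← integral_const_mul,
        ← integral_sub iB ifr, ← integral_sub i1 (iur.const_mul _),
        ← integral_add i2 (iP1.const_mul _), ← integral_add i3 (iP2.const_mul _),
        ← integral_add i4 iqr]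
      refine setIntegral_congr_fun measurableSet_Ioo fun y hy => ?_
      simp only [← hf y (Ioo_subset_Icc_self hy)]
      rw [hrdef, hrdef']
      ring
    rw [e1, hweak, hparts]
    ring
  -- Young's inequality on both products; the half energy is then absorbed on the left.
  have hle : energy ε b r r' ≤ (1 / 2) * energy ε b r r' +
      ((1 / 2) * (ε ^ 2 * (∫ y in I, u₀' y ^ 2)) +
      (1 / 2) * (b₀⁻¹ * ∫ y in I, (b y * P y - ε ^ 2 * P₂ y) ^ 2)) := by
    conv_lhs => rw [hid]
    rw [energy, ← integral_const_mul, ← integral_const_mul, ← integral_const_mul,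
      ← integral_const_mul, ← integral_const_mul, ← integral_const_mul, ← integral_neg,
      ← integral_add (iur.const_mul _).fun_neg iqr,
      ← integral_add ((iu2.const_mul _).const_mul _) ((iq2.const_mul _).const_mul _),
      ← integral_add (iE.const_mul _)
        (((iu2.const_mul _).const_mul _).fun_add ((iq2.const_mul _).const_mul _))]
    refine setIntegral_mono_on ((iur.const_mul _).fun_neg.fun_add iqr) ((iE.const_mul _).add
        (((iu2.const_mul _).const_mul _).fun_add ((iq2.const_mul _).const_mul _)))
      measurableSet_Ioo fun y hy => ?_
    set q := b y * P y - ε ^ 2 * P₂ y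
    have h1 := mul_nonneg (sq_nonneg ε) (sq_nonneg (u₀' y + r' y))
    have h2 : 0 ≤ b₀⁻¹ * (q - b₀ * r y) ^ 2 := by positivity
    have h3 : b₀⁻¹ * (q - b₀ * r y) ^ 2 = b₀⁻¹ * q ^ 2 - 2 * (q * r y) + b₀ * r y ^ 2 := by
      field_simp
      ring
    have h4 := mul_le_mul_of_nonneg_right (hbb₀ y (Ioo_subset_Icc_self hy)) (sq_nonneg (r y))
    linarith
  linarith

end Energy

/-! ### Boundary layer functions and their residual -/

section Layer

theorem mul_exp_neg_le_one (t : ℝ) : t * Real.exp (-t) ≤ 1 := by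
  rw [Real.exp_neg, ← div_eq_mul_inv, div_le_one (Real.exp_pos t)]
  linarith [Real.add_one_le_exp t]

/-- Since `t e⁻ᵗ ≤ 1`, a layer is O(ε) at distance at least 1; it is needed at the opposite end
point, `c = 2`. -/
theorem exp_neg_div_le {a ε c : ℝ} (ha : 0 < a) (hε : 0 < ε) (hc : 1 ≤ c) :
    Real.exp (-(a / ε) * c) ≤ ε / a := by
  have hae : 0 < a / ε := by positivity
  have h1 := mul_exp_neg_le_one (a / ε)
  have h2 : Real.exp (-(a / ε) * c) ≤ Real.exp (-(a / ε)) := by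
    rw [Real.exp_le_exp]; nlinarith
  refine h2.trans ?_
  rw [show ε / a = 1 / (a / ε) from (one_div_div a ε).symm, le_div_iff₀ hae]
  linarith

/-- One exponential absorbs the weight, `(1 + y) e ≤ ε / a`, and integrating the other supplies a
second factor `ε / a`. -/
theorem integral_layer_left_le {a ε : ℝ} (ha : 0 < a) (hε : 0 < ε) :
    ∫ y in (-1 : ℝ)..1, (1 + y) * Real.exp (-(a / ε) * (1 + y)) ^ 2 ≤ (ε / a) ^ 2 := by
  have hae : 0 < a / ε := by positivity
  have hint : ∫ y in (-1 : ℝ)..1, ε / a * Real.exp (-(a / ε) * (1 + y)) ≤ (ε / a) ^ 2 := by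
    have hd : ∀ y ∈ uIcc (-1 : ℝ) 1,
        HasDerivAt (fun y => -(ε / a) ^ 2 * Real.exp (-(a / ε) * (1 + y)))
          (ε / a * Real.exp (-(a / ε) * (1 + y))) y := by
      intro y _
      have h1 : HasDerivAt (fun y : ℝ => -(a / ε) * (1 + y)) (-(a / ε) * 1) y :=
        ((hasDerivAt_id y).const_add 1).const_mul _
      have := h1.exp.const_mul (-(ε / a) ^ 2)
      convert! this using 1
      field_simp
    rw [intervalIntegral.integral_eq_sub_of_hasDerivAt hd
      (Continuous.intervalIntegrable (by fun_prop) _ _)]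
    have := mul_nonneg (sq_nonneg (ε / a)) (Real.exp_pos (-(a / ε) * (1 + 1))).le
    simp only [add_neg_cancel, mul_zero, Real.exp_zero]
    linarith
  refine le_trans (intervalIntegral.integral_mono_on (by norm_num)
    (Continuous.intervalIntegrable (by fun_prop) _ _)
    (Continuous.intervalIntegrable (by fun_prop) _ _) fun y hy => ?_) hint
  have h1 := mul_exp_neg_le_one (a / ε * (1 + y))
  rw [← neg_mul] at h1
  have h2 := (Real.exp_pos (-(a / ε) * (1 + y))).le
  have h3 : (1 + y) * Real.exp (-(a / ε) * (1 + y)) ≤ ε / a := by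
    rw [show ε / a = 1 / (a / ε) from (one_div_div a ε).symm, le_div_iff₀ hae]
    linarith
  rw [sq, ← mul_assoc]
  gcongr

theorem integral_layer_right_le {a ε : ℝ} (ha : 0 < a) (hε : 0 < ε) :
    ∫ y in (-1 : ℝ)..1, (1 - y) * Real.exp (-(a / ε) * (1 - y)) ^ 2 ≤ (ε / a) ^ 2 := by
  have h := intervalIntegral.integral_comp_neg (a := -1) (b := 1)
    (fun y : ℝ => (1 + y) * Real.exp (-(a / ε) * (1 + y)) ^ 2)
  simp only [← sub_eq_add_neg, neg_neg] at h
  rw [h]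
  exact integral_layer_left_le ha hε

theorem hasDerivAt_layer_left (c y : ℝ) :
    HasDerivAt (fun y => Real.exp (-c * (1 + y))) (-c * Real.exp (-c * (1 + y))) y := by
  have h1 : HasDerivAt (fun y : ℝ => -c * (1 + y)) (-c * 1) y :=
    ((hasDerivAt_id y).const_add 1).const_mul _
  convert! h1.exp using 1
  ring

theorem hasDerivAt_layer_right (c y : ℝ) :
    HasDerivAt (fun y => Real.exp (-c * (1 - y))) (c * Real.exp (-c * (1 - y))) y := by
  have h1 : HasDerivAt (fun y : ℝ => -c * (1 - y)) (-c * -1) y :=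
    ((hasDerivAt_id y).const_sub 1).const_mul _
  convert! h1.exp using 1
  ring

/-- Bound for the residual of the boundary layer corrector. -/
theorem integral_residual_sq_le {α β ε A B K M : ℝ} {b q : ℝ → ℝ} (hα : 0 < α) (hβ : 0 < β)
    (hε : 0 < ε) (hb0 : ∀ y ∈ Icc (-1 : ℝ) 1, 0 ≤ b y)
    (hbM : ∀ y ∈ Icc (-1 : ℝ) 1, b y ≤ M)
    (hq : Integrable (fun y => q y ^ 2) (volume.restrict I))
    (hl : ∀ y ∈ Icc (-1 : ℝ) 1, (b y - α ^ 2) ^ 2 ≤ (1 + y) * K)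
    (hr : ∀ y ∈ Icc (-1 : ℝ) 1, (b y - β ^ 2) ^ 2 ≤ (1 - y) * K)
    (hqdef : ∀ y, q y = A * ((b y - α ^ 2) * Real.exp (-(α / ε) * (1 + y))) +
      B * ((b y - β ^ 2) * Real.exp (-(β / ε) * (1 - y))) +
      b y * (-(B * Real.exp (-(β / ε) * 2) * (1 - y) + A * Real.exp (-(α / ε) * 2) * (1 + y)) / 2)) :
    ∫ y in I, q y ^ 2 ≤ (3 * K + 12 * M ^ 2) * ((A / α) ^ 2 + (B / β) ^ 2) * ε ^ 2 := by
  have hK : 0 ≤ K := by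
    have := hl 1 (by norm_num)
    nlinarith [sq_nonneg (b 1 - α ^ 2)]
  set S := (A / α) ^ 2 + (B / β) ^ 2 with hS
  have hpt : ∀ y ∈ Icc (-1 : ℝ) 1, q y ^ 2 ≤
      3 * A ^ 2 * K * ((1 + y) * Real.exp (-(α / ε) * (1 + y)) ^ 2) +
      3 * B ^ 2 * K * ((1 - y) * Real.exp (-(β / ε) * (1 - y)) ^ 2) + 6 * M ^ 2 * S * ε ^ 2 := by
    intro y hy
    rw [hqdef y]
    set e₁ := Real.exp (-(α / ε) * (1 + y))
    set e₂ := Real.exp (-(β / ε) * (1 - y))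
    set L := -(B * Real.exp (-(β / ε) * 2) * (1 - y) + A * Real.exp (-(α / ε) * 2) * (1 + y)) / 2
      with hL
    -- The coefficients of the affine corrector are layer values at distance 2, each O(ε).
    have hLsq : L ^ 2 ≤ 2 * S * ε ^ 2 := by
      have p1 : (B * Real.exp (-(β / ε) * 2)) ^ 2 ≤ (B / β) ^ 2 * ε ^ 2 := by
        have := pow_le_pow_left₀ (Real.exp_pos _).le (exp_neg_div_le (c := 2) hβ hε (by norm_num)) 2
        calc _ = B ^ 2 * Real.exp (-(β / ε) * 2) ^ 2 := by ring
          _ ≤ B ^ 2 * (ε / β) ^ 2 := by gcongr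
          _ = _ := by ring
      have p2 : (A * Real.exp (-(α / ε) * 2)) ^ 2 ≤ (A / α) ^ 2 * ε ^ 2 := by
        have := pow_le_pow_left₀ (Real.exp_pos _).le (exp_neg_div_le (c := 2) hα hε (by norm_num)) 2
        calc _ = A ^ 2 * Real.exp (-(α / ε) * 2) ^ 2 := by ring
          _ ≤ A ^ 2 * (ε / α) ^ 2 := by gcongr
          _ = _ := by ring
      set z₁ := B * Real.exp (-(β / ε) * 2)
      set z₂ := A * Real.exp (-(α / ε) * 2)
      have t1 : (1 - y) ^ 2 ≤ 4 := by nlinarith [hy.1, hy.2]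
      have t2 : (1 + y) ^ 2 ≤ 4 := by nlinarith [hy.1, hy.2]
      have m1 := mul_le_mul_of_nonneg_left t1 (sq_nonneg z₁)
      have m2 := mul_le_mul_of_nonneg_left t2 (sq_nonneg z₂)
      have m3 : L ^ 2 ≤ (z₁ ^ 2 * (1 - y) ^ 2 + z₂ ^ 2 * (1 + y) ^ 2) / 2 := by
        rw [hL]
        nlinarith [sq_nonneg (z₁ * (1 - y) - z₂ * (1 + y))]
      rw [hS]
      linarith
    have hbL : (b y * L) ^ 2 ≤ 2 * M ^ 2 * S * ε ^ 2 := by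
      have h1 : b y ^ 2 ≤ M ^ 2 := pow_le_pow_left₀ (hb0 y hy) (hbM y hy) 2
      have := mul_le_mul h1 hLsq (sq_nonneg _) (sq_nonneg _)
      rw [mul_pow]
      linarith
    have h1 := mul_le_mul_of_nonneg_left (hl y hy) (sq_nonneg (A * e₁))
    have h2 := mul_le_mul_of_nonneg_left (hr y hy) (sq_nonneg (B * e₂))
    have h3 : ∀ a b c : ℝ, (a + b + c) ^ 2 ≤ 3 * a ^ 2 + 3 * b ^ 2 + 3 * c ^ 2 := fun a b c => by
      nlinarith [sq_nonneg (a - b), sq_nonneg (b - c), sq_nonneg (a - c)]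
    refine (h3 _ _ _).trans ?_
    linarith
  have c1 : IntervalIntegrable (fun y => 3 * A ^ 2 * K *
      ((1 + y) * Real.exp (-(α / ε) * (1 + y)) ^ 2)) volume (-1) 1 :=
    Continuous.intervalIntegrable (by fun_prop) _ _
  have c2 : IntervalIntegrable (fun y => 3 * B ^ 2 * K *
      ((1 - y) * Real.exp (-(β / ε) * (1 - y)) ^ 2)) volume (-1) 1 :=
    Continuous.intervalIntegrable (by fun_prop) _ _
  rw [integral_I_eq]
  refine (intervalIntegral.integral_mono_on (by norm_num) (intervalIntegrable_iff_I.2 hq)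
    ((c1.add c2).add (by simp)) hpt).trans ?_
  rw [intervalIntegral.integral_add (c1.add c2) (by simp), intervalIntegral.integral_add c1 c2,
    intervalIntegral.integral_const_mul, intervalIntegral.integral_const_mul,
    intervalIntegral.integral_const, smul_eq_mul]
  have k1 := mul_le_mul_of_nonneg_left (integral_layer_left_le hα hε)
    (by positivity : 0 ≤ 3 * A ^ 2 * K)
  have k2 := mul_le_mul_of_nonneg_left (integral_layer_right_le hβ hε)
    (by positivity : 0 ≤ 3 * B ^ 2 * K)
  have k3 : (3 * K + 12 * M ^ 2) * S * ε ^ 2 = 3 * A ^ 2 * K * (ε / α) ^ 2 +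
      3 * B ^ 2 * K * (ε / β) ^ 2 + (1 - -1) * (6 * M ^ 2 * S * ε ^ 2) := by
    rw [hS]; ring
  linarith

end Layer

/-! ### Best approximation by the Galerkin solution -/

/-- `w` is a polynomial of degree at most one on each element. -/
def IsPiecewiseLinear (N : ℕ) (x : ℕ → ℝ) (w : ℝ → ℝ) : Prop :=
  ∀ j < N, ∃ p : Polynomial ℝ, p.natDegree ≤ 1 ∧ ∀ y ∈ Icc (x j) (x (j + 1)), w y = p.eval y

section Galerkin

variable {N : ℕ} {x : ℕ → ℝ} {v w : ℝ → ℝ}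

theorem IsPiecewiseLinear.sub (hv : IsPiecewiseLinear N x v) (hw : IsPiecewiseLinear N x w) :
    IsPiecewiseLinear N x (fun y => v y - w y) := by
  intro j hj
  obtain ⟨p, hp1, hp2⟩ := hv j hj
  obtain ⟨q, hq1, hq2⟩ := hw j hj
  exact ⟨p - q, Polynomial.natDegree_sub_le_of_le hp1 hq1, fun y hy => by
    simp only [hp2 y hy, hq2 y hy, Polynomial.eval_sub]⟩

theorem IsPiecewiseLinear.const_mul (c : ℝ) (hw : IsPiecewiseLinear N x w) :
    IsPiecewiseLinear N x (fun y => c * w y) := by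
  intro j hj
  obtain ⟨q, hq1, hq2⟩ := hw j hj
  exact ⟨Polynomial.C c * q, (Polynomial.natDegree_C_mul_le c q).trans hq1, fun y hy => by
    simp only [hq2 y hy, Polynomial.eval_mul, Polynomial.eval_C]⟩

theorem isPiecewiseLinear_affine (c d : ℝ) : IsPiecewiseLinear N x (fun y => c * y + d) :=
  fun _ _ => ⟨Polynomial.C c * Polynomial.X + Polynomial.C d, Polynomial.natDegree_linear_le,
    fun y _ => by simp⟩

/-- The Galerkin approximation is the best approximation in the energy norm. -/
theorem energy_galerkin_le {ε : ℝ} {b c f u uΔ ut ug ud dg g : ℝ → ℝ}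
    (hb : b =ᵐ[volume.restrict I] c) (hc : ContinuousOn c (Icc (-1) 1))
    (hc0 : ∀ y ∈ Icc (-1 : ℝ) 1, 0 ≤ c y)
    (hu : u =ᵐ[volume.restrict I] ut) (hut : HasL2Deriv ut ug)
    (hd : uΔ =ᵐ[volume.restrict I] ud) (hud : HasL2Deriv ud dg) (hd1 : ud (-1) = 0)
    (hd2 : ud 1 = 0) (hsol : IsWeakSolution ε b f u) (hgal : IsGalerkinSolution ε b f N x uΔ)
    (hv : HasL2Deriv v g) (hvp : IsPiecewiseLinear N x v) (hv1 : v (-1) = 0) (hv2 : v 1 = 0) :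
    energy ε c (fun y => ut y - ud y) (fun y => ug y - dg y) ≤
      energy ε c (fun y => ut y - v y) (fun y => ug y - g y) := by
  have hz := hud.sub hv
  have hze : (fun y => uΔ y - v y) =ᵐ[volume.restrict I] fun y => ud y - v y := by
    filter_upwards [hd] with y hy
    rw [hy]
  have hz10 : MemH10 (fun y => uΔ y - v y) :=
    hz.memH10 hze (by simp only [hd1, hv1, sub_self]) (by simp only [hd2, hv2, sub_self])
  have hzS : MemS10 N x (fun y => uΔ y - v y) := by
    refine ⟨hz10, fun j hj => ?_⟩
    obtain ⟨p, hp1, hp2⟩ := hgal.1.2 j hj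
    obtain ⟨q, hq1, hq2⟩ := hvp j hj
    refine ⟨p - q, Polynomial.natDegree_sub_le_of_le hp1 hq1, ?_⟩
    filter_upwards [hp2, ae_restrict_mem measurableSet_Icc] with y h1 h2
    rw [h1, hq2 y h2, Polynomial.eval_sub]
  have e1 := hsol.2 _ hz10
  have e2 := hgal.2 _ hzS
  -- `uΔ - v` is admissible in both the continuous and the discrete equation; their difference is
  -- Galerkin orthogonality.
  rw [← e2, bilin_eq hb hu hut hze hz, bilin_eq hb hd hud hze hz] at e1
  have horth : ∫ y in I, (ε ^ 2 * (ug y - dg y) * (dg y - g y) +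
      c y * (ut y - ud y) * (ud y - v y)) = 0 := by
    rw [← sub_eq_zero, ← integral_sub (integrable_bilin hc hut hz) (integrable_bilin hc hud hz)]
      at e1
    rw [← e1]
    exact integral_congr_ae (Eventually.of_forall fun y => by ring)
  have := energy_le_of_orthogonal hc hc0 (hut.sub hud) hz horth
  simpa only [sub_add_sub_cancel] using this

end Galerkin

/-! ### The discrete comparison function -/

theorem isMesh_eXpNode {θ ε : ℝ} {m : ℕ} (hθ : 0 < θ) (hε : 0 < ε) (hm : 0 < m)
    (hL : θ * ε * Real.log (2 * m) < 1) (hN : ε ≤ 1 / (4 * m)) :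
    IsMesh (4 * m) (eXpNode θ ε (4 * m)) where
  zero := eXpNode_zero hm
  last := eXpNode_last hm
  lt _ hj := sub_pos.1 (eXpNode_step hθ hε hm hL hN hj).1

theorem HasL2Deriv.sq_sub_left_le {w g : ℝ → ℝ} (hw : HasL2Deriv w g) {y : ℝ}
    (hy : y ∈ Icc (-1 : ℝ) 1) : (w y - w (-1)) ^ 2 ≤ (1 + y) * ∫ t in I, g t ^ 2 := by
  have h := hw.sq_sub_le hy.1 le_rfl hy.2
  have h2 : ∫ t in (-1 : ℝ)..y, g t ^ 2 ≤ ∫ t in (-1 : ℝ)..1, g t ^ 2 :=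
    intervalIntegral.integral_mono_interval le_rfl hy.1 hy.2
      (Eventually.of_forall fun _ => sq_nonneg _)
      (intervalIntegrable_iff_I.2 (integrable_sq_of_memLp hw.memLp))
  rw [integral_I_eq]
  refine h.trans ?_
  rw [show y - -1 = 1 + y by ring]
  exact mul_le_mul_of_nonneg_left h2 (by linarith [hy.1])

theorem HasL2Deriv.sq_sub_right_le {w g : ℝ → ℝ} (hw : HasL2Deriv w g) {y : ℝ}
    (hy : y ∈ Icc (-1 : ℝ) 1) : (w y - w 1) ^ 2 ≤ (1 - y) * ∫ t in I, g t ^ 2 := by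
  have h := hw.sq_sub_le hy.2 hy.1 le_rfl
  have h2 : ∫ t in y..1, g t ^ 2 ≤ ∫ t in (-1 : ℝ)..1, g t ^ 2 :=
    intervalIntegral.integral_mono_interval hy.1 hy.2 le_rfl
      (Eventually.of_forall fun _ => sq_nonneg _)
      (intervalIntegrable_iff_I.2 (integrable_sq_of_memLp hw.memLp))
  rw [integral_I_eq, ← neg_sub, neg_sq]
  refine h.trans ?_
  exact mul_le_mul_of_nonneg_left h2 (by linarith [hy.2])

/-- The approximant is the nodal interpolant of `u₀ - A E - B F`, minus `L`, so the error is `r`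
plus three interpolation errors. `C` is fixed before `ε` and `m`. -/
theorem exists_approx {c k f u₀ g₀ : ℝ → ℝ} {b₀ M θ : ℝ} (hb₀ : 0 < b₀) (hθ : 0 < θ)
    (hθb : 1 ≤ √b₀ * θ) (hc : HasL2Deriv c k) (hcb₀ : ∀ y ∈ Icc (-1 : ℝ) 1, b₀ ≤ c y)
    (hcM : ∀ y ∈ Icc (-1 : ℝ) 1, c y ≤ M) (hu₀ : HasL2Deriv u₀ g₀)
    (hf : ∀ y ∈ Icc (-1 : ℝ) 1, c y * u₀ y = f y) :
    ∃ C : ℝ, 0 ≤ C ∧ ∀ (ε : ℝ) (m : ℕ), 0 < ε → 0 < m → ε ≤ 1 / (4 * m) →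
      θ * ε * Real.log (2 * m) < 1 → ∀ u g : ℝ → ℝ, HasL2Deriv u g → u (-1) = 0 → u 1 = 0 →
      (∀ w h, HasL2Deriv w h → w (-1) = 0 → w 1 = 0 →
        ∫ y in I, (ε ^ 2 * g y * h y + c y * u y * w y) = ∫ y in I, f y * w y) →
      ∃ v h, HasL2Deriv v h ∧ IsPiecewiseLinear (4 * m) (eXpNode θ ε (4 * m)) v ∧
        v (-1) = 0 ∧ v 1 = 0 ∧
        energy ε c (fun y => u y - v y) (fun y => g y - h y) ≤ C * (1 / (4 * m)) ^ 2 := by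
  have mem1 : (-1 : ℝ) ∈ Icc (-1 : ℝ) 1 := by norm_num
  have mem2 : (1 : ℝ) ∈ Icc (-1 : ℝ) 1 := by norm_num
  have hc0 : ∀ y ∈ Icc (-1 : ℝ) 1, 0 ≤ c y := fun y hy => hb₀.le.trans (hcb₀ y hy)
  have hM : 0 ≤ M := (hc0 1 mem2).trans (hcM 1 mem2)
  set α := √(c (-1))
  set β := √(c 1)
  have hαsq : α ^ 2 = c (-1) := Real.sq_sqrt (hc0 _ mem1)
  have hβsq : β ^ 2 = c 1 := Real.sq_sqrt (hc0 _ mem2)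
  have hα : 0 < α := Real.sqrt_pos.2 (hb₀.trans_le (hcb₀ _ mem1))
  have hβ : 0 < β := Real.sqrt_pos.2 (hb₀.trans_le (hcb₀ _ mem2))
  have hαθ : 1 ≤ α * θ :=
    hθb.trans (mul_le_mul_of_nonneg_right (Real.sqrt_le_sqrt (hcb₀ _ mem1)) hθ.le)
  have hβθ : 1 ≤ β * θ :=
    hθb.trans (mul_le_mul_of_nonneg_right (Real.sqrt_le_sqrt (hcb₀ _ mem2)) hθ.le)
  set A := u₀ (-1)
  set B := u₀ 1
  set G := ∫ y in I, g₀ y ^ 2 with hG_def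
  set K := ∫ y in I, k y ^ 2
  have hG : 0 ≤ G := integral_nonneg fun _ => sq_nonneg _
  have hK : 0 ≤ K := integral_nonneg fun _ => sq_nonneg _
  -- Bounds for the remainder, the reduced solution and the left and right layers, in units of `1 /
  -- N²`. The factor 4 comes from splitting the energy of a sum twice.
  set Cr := G + b₀⁻¹ * ((3 * K + 12 * M ^ 2) * ((A / α) ^ 2 + (B / β) ^ 2)) with hCr
  set Cu := (4 + 4 * M * (2 * θ + 4) ^ 2) * G with hCu
  set Cα := A ^ 2 * (2 * (α ^ 2 + M) * (4 * (α * θ) + 2) ^ 2) with hCα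
  set Cβ := B ^ 2 * (2 * (β ^ 2 + M) * (4 * (β * θ) + 2) ^ 2) with hCβ
  refine ⟨4 * (Cr + Cu + Cα + Cβ), by positivity, ?_⟩
  intro ε m hε hm hN hL u g hu hu1 hu2 hweak
  set η := 1 / (4 * (m : ℝ)) with hη
  have hεη : ε ^ 2 ≤ η ^ 2 := pow_le_pow_left₀ hε.le hN 2
  have hx := isMesh_eXpNode hθ hε hm hL hN
  set x := eXpNode θ ε (4 * m)
  set E := fun y : ℝ => Real.exp (-(α / ε) * (1 + y)) with hE
  set F := fun y : ℝ => Real.exp (-(β / ε) * (1 - y)) with hF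
  have hEd : ∀ y, HasDerivAt E (-(α / ε) * E y) y := hasDerivAt_layer_left (α / ε)
  have hFd : ∀ y, HasDerivAt F (β / ε * F y) y := hasDerivAt_layer_right (β / ε)
  have hEW : HasL2Deriv E (fun y => -(α / ε) * E y) := .of_hasDerivAt hEd (by fun_prop)
  have hFW : HasL2Deriv F (fun y => β / ε * F y) := .of_hasDerivAt hFd (by fun_prop)
  set p := B * Real.exp (-(β / ε) * 2) with hp
  set q := A * Real.exp (-(α / ε) * 2) with hq
  -- The affine function with values `-p` at -1 and `-q` at 1, cancelling the opposite layer's value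
  -- at each end.
  set L := fun y : ℝ => (p - q) / 2 * y + -(p + q) / 2 with hLdef
  have hLW : HasL2Deriv L (fun _ => (p - q) / 2) := by
    refine .of_hasDerivAt (fun y => ?_) continuous_const
    have := ((hasDerivAt_id y).const_mul ((p - q) / 2)).add_const (-(p + q) / 2)
    rwa [mul_one] at this
  have hL0 : HasL2Deriv (fun _ => (p - q) / 2) (fun _ => 0) :=
    .of_hasDerivAt (fun y => hasDerivAt_const _ _) continuous_const
  have hPW := ((hEW.const_mul A).add (hFW.const_mul B)).add hLW
  have hP1W := (((hEW.const_mul (-(α / ε))).const_mul A).add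
    ((hFW.const_mul (β / ε)).const_mul B)).add hL0
  have hrW := (hu.sub hu₀).add hPW
  have hE1 : E (-1) = 1 := by simp [hE]
  have hF1 : F 1 = 1 := by simp [hF]
  have hE2 : E 1 = Real.exp (-(α / ε) * 2) := by simp only [hE]; norm_num
  have hF2 : F (-1) = Real.exp (-(β / ε) * 2) := by simp only [hF]; norm_num
  have hr1 : u (-1) - u₀ (-1) + (A * E (-1) + B * F (-1) + L (-1)) = 0 := by
    rw [hu1, hE1, hF2, ← hp]
    simp only [hLdef]
    ring
  have hr2 : u 1 - u₀ 1 + (A * E 1 + B * F 1 + L 1) = 0 := by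
    rw [hu2, hF1, hE2, ← hq]
    simp only [hLdef]
    ring
  have hres := energy_residual_le hb₀ hc.continuousOn hcb₀ hu hu₀ hPW hP1W hrW (fun _ => rfl)
    (fun _ => rfl) hr1 hr2 hf (hweak _ _ hrW hr1 hr2)
  -- In `b P - ε² P₂` the second derivatives contribute `α² E` and `β² F`, leaving the factors `b -
  -- b(-1)` and `b - b(1)`.
  have hsq := integral_residual_sq_le (A := A) (B := B) (K := K) hα hβ hε hc0 hcM
    (integrable_sq_of_memLp ((memLp_continuousOn_mul hc.continuousOn hPW.memLp_self).sub
      (hP1W.memLp.const_mul (ε ^ 2))))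
    (fun y hy => by rw [hαsq]; exact hc.sq_sub_left_le hy)
    (fun y hy => by rw [hβsq]; exact hc.sq_sub_right_le hy)
    (fun y => by
      simp only [Pi.sub_apply, hLdef, hE, hF, hp, hq]
      field_simp
      ring)
  have hrC := hres.trans (c := Cr * η ^ 2) (by
    refine le_trans ?_ (mul_le_mul_of_nonneg_left hεη (by positivity : 0 ≤ Cr))
    have := mul_le_mul_of_nonneg_left hsq (inv_nonneg.2 hb₀.le)
    rw [hCr]
    simp only [Pi.sub_apply] at this
    linarith only [this])
  have hsub : ∀ j < 4 * m, x (j + 1) - x j ≤ (2 * θ + 4) * η := fun j hj =>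
    (eXpNode_step hθ hε hm hL hN hj).2
  have huC := energy_interp_le (ε := ε) hx hc.continuousOn hM hcM hsub hu₀
  have huC' : energy ε c (fun y => u₀ y - interp (4 * m) x u₀ y)
      (fun y => g₀ y - interpSlope (4 * m) x u₀ y) ≤ Cu * η ^ 2 := by
    refine huC.trans ?_
    rw [hCu, ← hG_def]
    have := mul_le_mul_of_nonneg_right hεη hG
    linarith only [this]
  have hαε : (ε * -(α / ε)) ^ 2 = α ^ 2 := by field_simp
  have hβε : (ε * (β / ε)) ^ 2 = β ^ 2 := by field_simp
  have hEa : Antitone E := fun y z hyz => Real.exp_le_exp.2 <|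
    mul_le_mul_of_nonpos_left (by linarith only [hyz]) (neg_nonpos.2 (by positivity))
  have hFm : Monotone F := fun y z hyz => Real.exp_le_exp.2 <|
    mul_le_mul_of_nonpos_left (by linarith only [hyz]) (neg_nonpos.2 (by positivity))
  have hEC := energy_interp_exp_le (ε := ε) hx hc.continuousOn hM hcM hEd (Or.inr hEa)
    fun j hj => abs_layer_step_left hθ hε hm hL hN hα hαθ hj
  have hFC := energy_interp_exp_le (ε := ε) hx hc.continuousOn hM hcM hFd (Or.inl hFm)
    fun j hj => abs_layer_step_right hθ hε hm hL hN hβ hβθ hj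
  rw [hαε] at hEC
  rw [hβε] at hFC
  have hIu := hasL2Deriv_interp (N := 4 * m) (x := x) (w := u₀)
  have hIE := hasL2Deriv_interp (N := 4 * m) (x := x) (w := E)
  have hIF := hasL2Deriv_interp (N := 4 * m) (x := x) (w := F)
  refine ⟨_, _, ((hIu.sub (hIE.const_mul A)).sub (hIF.const_mul B)).sub hLW, ?_, ?_, ?_, ?_⟩
  · refine IsPiecewiseLinear.sub (.sub (.sub ?_ (.const_mul A ?_)) (.const_mul B ?_))
      (isPiecewiseLinear_affine _ _) <;> exact fun j hj => interp_eq_eval hx hj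
  · rw [interp_neg_one hx, interp_neg_one hx, interp_neg_one hx]
    linarith only [hr1, hu1]
  · rw [interp_one hx, interp_one hx, interp_one hx]
    linarith only [hr2, hu2]
  have hEe := (hEW.sub hIE).const_mul (-A)
  have hFe := (hFW.sub hIF).const_mul (-B)
  have s1 := energy_add_le (ε := ε) hc.continuousOn hc0 hrW (hu₀.sub hIu)
  have s2 := energy_add_le (ε := ε) hc.continuousOn hc0 hEe hFe
  have s3 := energy_add_le (ε := ε) hc.continuousOn hc0 (hrW.add (hu₀.sub hIu)) (hEe.add hFe)
  rw [energy_const_mul, energy_const_mul, neg_sq, neg_sq] at s2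
  have hEC' := mul_le_mul_of_nonneg_left hEC (sq_nonneg A)
  have hFC' := mul_le_mul_of_nonneg_left hFC (sq_nonneg B)
  have hfin := s3.trans (c := 4 * (Cr + Cu + Cα + Cβ) * η ^ 2) (by
    rw [hCα, hCβ]
    linarith only [s1, s2, hrC, huC', hEC', hFC'])
  convert! hfin using 2
  · funext y; ring
  · funext y; ring

end ReactionDiffusion

end

theorem proposition3p2 (b f : ℝ → ℝ) (hb : ReactionDiffusion.MemH1 b)
    (hf : ReactionDiffusion.MemH1 f) (b₀ : ℝ) (hb₀ : 0 < b₀)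
    (hbb₀ : ∀ᵐ x ∂volume.restrict ReactionDiffusion.I, b₀ ≤ b x) :
    ∃ C : ℝ, 0 < C ∧
      ∀ ε : ℝ, 0 < ε → ε ≤ 1 →
        ∀ N : ℕ, 1 ≤ N → (N : ℝ) ≤ 1 / ε → 4 ∣ N →
          -- the transition points are ordered, i.e. the nodes form a mesh of `[-1, 1]`
          ReactionDiffusion.theta b₀ * ε * Real.log ((N : ℝ) / 2) < 1 →
          ∀ u uΔ : ℝ → ℝ,
            ReactionDiffusion.IsWeakSolution ε b f u →
            ReactionDiffusion.IsGalerkinSolution ε b f N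
              (ReactionDiffusion.eXpNode (ReactionDiffusion.theta b₀) ε N) uΔ →
            ReactionDiffusion.energyNorm ε b (fun x => u x - uΔ x) ≤ C * (N : ℝ)⁻¹ := by
  open ReactionDiffusion Set in
  obtain ⟨c, hbc, hc⟩ := hb.exists_rep
  obtain ⟨d, hfd, hd⟩ := hf.exists_rep
  have hcb₀ : ∀ y ∈ Icc (-1 : ℝ) 1, b₀ ≤ c y := by
    refine le_of_ae_le hc.continuousOn ?_
    filter_upwards [hbb₀, hbc] with y h1 h2
    rwa [← h2]
  obtain ⟨M, hM⟩ := isCompact_Icc.exists_bound_of_continuousOn hc.continuousOn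
  -- The reduced solution `f / b` inherits H¹ regularity because `b` is bounded below.
  obtain ⟨g₀, hu₀⟩ := hd.div hc hb₀ hcb₀
  have hs : 0 < √b₀ := Real.sqrt_pos.2 hb₀
  have hθ : 0 < theta b₀ := by
    unfold theta betaStar
    positivity
  -- The product equals 4; the layer estimate only needs exponents at least 1.
  have hθb : 1 ≤ √b₀ * theta b₀ := by
    rw [theta, betaStar]
    field_simp
    norm_num
  have hdu : ∀ y ∈ Icc (-1 : ℝ) 1, c y * (d y / c y) = d y := fun y hy =>
    mul_div_cancel₀ _ (hb₀.trans_le (hcb₀ y hy)).ne'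
  obtain ⟨C, hC, key⟩ := exists_approx hb₀ hθ hθb hc hcb₀
    (fun y hy => (le_abs_self _).trans (hM y hy)) hu₀ hdu
  -- The square root returns from squared energies to the norm; adding 1 makes the constant strictly
  -- positive.
  refine ⟨√C + 1, by positivity, ?_⟩
  rintro ε hε - N hN1 hNε ⟨m, rfl⟩ hL u uΔ hu huΔ
  have hm : 0 < m := by omega
  have hm' : (0 : ℝ) < m := by exact_mod_cast hm
  push_cast at hNε hL ⊢
  have hεm : ε ≤ 1 / (4 * m) := by
    rw [le_div_iff₀ hε] at hNε
    rw [le_div_iff₀ (by positivity)]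
    linarith
  rw [show 4 * (m : ℝ) / 2 = 2 * m by ring] at hL
  obtain ⟨w, huw, hw, hw1, hw2⟩ := hu.1.exists_rep
  obtain ⟨z, huz, hz, hz1, hz2⟩ := huΔ.1.1.exists_rep
  obtain ⟨v, h, hv, hvp, hv1, hv2, hle⟩ := key ε m hε hm hεm hL w _ hw hw1 hw2 (by
    intro t s ht ht1 ht2
    rw [← bilin_eq hbc huw hw (ae_eq_refl t) ht, ← load_eq hfd (ae_eq_refl t)]
    exact hu.2 t (ht.memH10 (ae_eq_refl t) ht1 ht2))
  have hbest := energy_galerkin_le hbc hc.continuousOn (fun y hy => hb₀.le.trans (hcb₀ y hy))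
    huw hw huz hz hz1 hz2 hu huΔ hv hvp hv1 hv2
  have heq : (fun y => u y - uΔ y) =ᵐ[volume.restrict I] fun y => w y - z y := by
    filter_upwards [huw, huz] with y h1 h2
    rw [h1, h2]
  rw [energyNorm_eq hbc heq (hw.sub hz)]
  refine (Real.sqrt_le_sqrt (hbest.trans hle)).trans ?_
  rw [Real.sqrt_mul hC, Real.sqrt_sq (by positivity), one_div]
  have : 0 ≤ (4 * (m : ℝ))⁻¹ := by positivity
  nlinarith
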